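/- Let $\mathcal{M}$ be a closed (compact, without boundary) smooth $d$-dimensional manifold with a smooth Riemannian metric $g$, normalized so that its Riemannian measure $\mu$ satisfies $\mu(\mathcal{M})=1$. All functions and vector fields are complex; $g$ is extended to complex tangent vectors conjugate-linearly in its first argument. Let $H=L^2(\mathcal{M},\mu)$ with $\langle f,h\rangle_H=\int_{\mathcal{M}} \bar f h\,d\mu$, let $\mathfrak{X}$ be the space of smooth complex vector fields, and let $H_{\mathfrak{X}}$ be the space of square-integrable complex vector fields, with norm $\|v\|_{H_{\mathfrak X}}^2=\int_{\mathcal{M}} g(v,v)\,d\mu$ (fields equal almost everywhere are identified). Let $\operatorname{div}$ also denote the closure, as an operator from $H_{\mathfrak{X}}$ to $H$, of the divergence $\mathfrak{X}\to C^\infty(\mathcal{M})$. Let $H^1\subset H$ be the Sobolev space of functions, i.e. the domain of the closure, as an operator from $H$ to $H_{\mathfrak X}$, of the gradient $C^\infty(\mathcal{M})\to\mathfrak{X}$, and let $H^1_{\mathfrak{X},\operatorname{div}}$ be the space of $v\in H_{\mathfrak{X}}$ in the domain of $\operatorname{div}$ with $\operatorname{div} v\in H^1$. For a vector field $v$ and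 a smooth function $f$ write $v(f)=df(v)$, and let $v^*$ be the complex conjugate field. For every $v\in H^1_{\mathfrak{X},\operatorname{div}}$ and $f\in C^\infty(\mathcal{M})$ the field $fv$ lies in the domain of $\operatorname{div}$ and $v(f)\in H$. Hence $D_v f=\operatorname{div}(fv)$ and $A_v f=v(f)+D_vf$ define linear operators $D_v,A_v:C^\infty(\mathcal{M})\to H$. They satisfy: 1. $\langle f,A_vh\rangle_H=-\langle A_{v^*}f,h\rangle_H$ for all $f,h\in C^\infty(\mathcal{M})$. 2. $A_v$ is the unique operator with this property: if $B:C^\infty(\mathcal{M})\to H$ satisfies $\langle f,Bh\rangle_H=-\langle A_{v^*}f,h\rangle_H$ for all $f,h\in C^\infty(\mathcal{M})$, then $B=A_v$. Moreover, for $u,v\in H^1_{\mathfrak{X},\operatorname{div}}$, $A_u=A_v$ if and only if $u=v$. 3. $v(f)=\tfrac12\left(A_vf-f\,A_v1\right)$ for all $f\in C^\infty(\mathcal{M})$. -/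

import Mathlib

open scoped Manifold ContDiff ENNReal
open MeasureTheory Filter Topology

noncomputable section

namespace SEC

/-- The model space `ℝ^d`. -/
abbrev Model (d : ℕ) : Type := EuclideanSpace ℝ (Fin d)

/-- A smooth Riemannian metric on (the real tangent bundle of) a smooth `d`-manifold `M`. -/
abbrev Metric (d : ℕ) (M : Type*) [TopologicalSpace M] [ChartedSpace (Model d) M]
    [IsManifold (𝓡 d) ∞ M] : Type _ :=
  Bundle.ContMDiffRiemannianMetric (𝓡 d) ∞ (Model d) (fun x : M => TangentSpace (𝓡 d) x)

section Fields

variable {d : ℕ} {M : Type*} [TopologicalSpace M] [ChartedSpace (Model d) M]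

/-- The ring `C^∞(M)` of smooth complex-valued functions, as a complex algebra. -/
def Smooth (d : ℕ) (M : Type*) [TopologicalSpace M] [ChartedSpace (Model d) M] :
    Subalgebra ℂ (M → ℂ) where
  carrier := {f | ContMDiff (𝓡 d) 𝓘(ℝ, ℂ) ∞ f}
  mul_mem' hf hg := contDiff_mul.contMDiff.comp (hf.prodMk_space hg)
  add_mem' hf hg := hf.add hg
  algebraMap_mem' _ := contMDiff_const

/-- The vector `∂_i` of the coordinate frame of the chart `φ` centred at `p`, at the point
`φ⁻¹(y)`. -/
def coordVec (p : M) (y : Model d) (i : Fin d) :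
    TangentSpace (𝓡 d) ((extChartAt (𝓡 d) p).symm y) :=
  mfderiv 𝓘(ℝ, Model d) (𝓡 d) (extChartAt (𝓡 d) p).symm y (EuclideanSpace.single i (1 : ℝ))

/-- The `i`-th component, in the chart centred at `p`, of a tangent vector `u` at `x`. -/
def coord (p x : M) (u : TangentSpace (𝓡 d) x) (i : Fin d) : ℝ :=
  (show Model d from mfderiv (𝓡 d) 𝓘(ℝ, Model d) (extChartAt (𝓡 d) p) x u) i

/-- A (not necessarily continuous) section of the complexified tangent bundle: at each point an
element `re + i im` of `T_x M ⊗ ℂ = T_x M ⊕ i T_x M`. -/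
@[ext] structure CField (d : ℕ) (M : Type*) [TopologicalSpace M]
    [ChartedSpace (Model d) M] where
  /-- the real part -/
  re : ∀ x : M, TangentSpace (𝓡 d) x
  /-- the imaginary part -/
  im : ∀ x : M, TangentSpace (𝓡 d) x

namespace CField

/-- Difference of two complex vector fields. -/
def sub (v w : CField d M) : CField d M := ⟨fun x => v.re x - w.re x, fun x => v.im x - w.im x⟩

/-- The complex conjugate `v^*`. -/
def conj (v : CField d M) : CField d M := ⟨v.re, fun x => -v.im x⟩

/-- The product `f v` of a complex function and a complex vector field. -/
def smul (f : M → ℂ) (v : CField d M) : CField d M :=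
  ⟨fun x => (f x).re • v.re x - (f x).im • v.im x,
   fun x => (f x).re • v.im x + (f x).im • v.re x⟩

/-- The function `v(f)`, i.e. `df(v)`, for a complex function `f`. -/
def apply (v : CField d M) (f : M → ℂ) (x : M) : ℂ :=
  (show ℂ from mfderiv (𝓡 d) 𝓘(ℝ, ℂ) f x (v.re x)) +
    Complex.I * (show ℂ from mfderiv (𝓡 d) 𝓘(ℝ, ℂ) f x (v.im x))

/-- `C^∞` complex vector fields. -/
def IsSmooth [IsManifold (𝓡 d) ∞ M] (v : CField d M) : Prop :=
  ContMDiff (𝓡 d) (𝓡 d).tangent ∞ (fun x => (⟨x, v.re x⟩ : TangentBundle (𝓡 d) M)) ∧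
  ContMDiff (𝓡 d) (𝓡 d).tangent ∞ (fun x => (⟨x, v.im x⟩ : TangentBundle (𝓡 d) M))

/-- Borel measurable sections: the components in every chart are measurable on the chart domain. -/
def IsMeasurable [MeasurableSpace M] (v : CField d M) : Prop :=
  ∀ (p : M) (i : Fin d),
    Measurable (fun x : (extChartAt (𝓡 d) p).source => coord p x.1 (v.re x.1) i) ∧
    Measurable (fun x : (extChartAt (𝓡 d) p).source => coord p x.1 (v.im x.1) i)

end CField

end Fields

section Riemannian

variable {d : ℕ} {M : Type*} [TopologicalSpace M] [ChartedSpace (Model d) M]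
  [IsManifold (𝓡 d) ∞ M]

/-- `√(det (g_ij))` in the chart centred at `p`, at the coordinate point `y`. -/
def volDensity (g : Metric d M) (p : M) (y : Model d) : ℝ :=
  √(Matrix.det (Matrix.of fun i j =>
    g.inner ((extChartAt (𝓡 d) p).symm y) (coordVec p y i) (coordVec p y j)))

/-- The Riemannian measure of the domain of the chart centred at `p`: the measure
`√(det g) dy¹ ⋯ dy^d` on the image of the chart, transported to `M`. -/
def chartMeasure [MeasurableSpace M] (g : Metric d M) (p : M) : Measure M :=
  (((volume : Measure (Model d)).restrict (extChartAt (𝓡 d) p).target).withDensity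
    (fun y => ENNReal.ofReal (volDensity g p y))).map (extChartAt (𝓡 d) p).symm

/-- The Riemannian measure. The measures of the chart domains agree on overlaps, and their
supremum is the measure that restricts to each of them. -/
def riemannianMeasure [MeasurableSpace M] (g : Metric d M) : Measure M :=
  ⨆ p : M, chartMeasure g p

/-- Divergence of a real vector field, `(1/√G) ∑ i, ∂_i (√G V^i)`, computed at `p` in the chart
centred at `p`. -/
def realDiv (g : Metric d M) (V : ∀ x : M, TangentSpace (𝓡 d) x) (p : M) : ℝ :=
  (volDensity g p (extChartAt (𝓡 d) p p))⁻¹ *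
    ∑ i : Fin d, fderiv ℝ
      (fun y : Model d => volDensity g p y *
        coord p ((extChartAt (𝓡 d) p).symm y) (V ((extChartAt (𝓡 d) p).symm y)) i)
      (extChartAt (𝓡 d) p p) (EuclideanSpace.single i (1 : ℝ))

/-- Divergence of a complex vector field. -/
def div (g : Metric d M) (v : CField d M) (p : M) : ℂ :=
  (realDiv g v.re p : ℂ) + Complex.I * (realDiv g v.im p : ℂ)

/-- The metric at `x`, as a bilinear form. -/
def bilin (g : Metric d M) (x : M) : LinearMap.BilinForm ℝ (TangentSpace (𝓡 d) x) :=
  LinearMap.mk₂ ℝ (fun u w => g.inner x u w) (by simp) (by simp) (by simp) (by simp)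

lemma bilin_nondegenerate (g : Metric d M) (x : M) : (bilin g x).Nondegenerate := by
  constructor
  · intro u hu
    by_contra h
    exact (g.pos x u h).ne' (hu u)
  · intro u hu
    by_contra h
    exact (g.pos x u h).ne' (hu u)

/-- Gradient of a real function: the vector with `g(grad u, w) = du(w)` for all `w`. -/
def realGrad (g : Metric d M) (u : M → ℝ) (x : M) : TangentSpace (𝓡 d) x :=
  haveI : FiniteDimensional ℝ (TangentSpace (𝓡 d) x) :=
    inferInstanceAs (FiniteDimensional ℝ (Model d))
  ((bilin g x).toDual (bilin_nondegenerate g x)).symm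
    (show TangentSpace (𝓡 d) x →L[ℝ] ℝ from mfderiv (𝓡 d) 𝓘(ℝ, ℝ) u x).toLinearMap

/-- Gradient of a complex function. -/
def grad (g : Metric d M) (f : M → ℂ) : CField d M :=
  ⟨realGrad g (fun x => (f x).re), realGrad g (fun x => (f x).im)⟩

lemma realGrad_neg (g : Metric d M) (u : M → ℝ) (x : M) :
    realGrad g (fun x => -u x) x = -realGrad g u x := by
  have h : mfderiv (𝓡 d) 𝓘(ℝ, ℝ) (fun x => -u x) x = -mfderiv (𝓡 d) 𝓘(ℝ, ℝ) u x :=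
    mfderiv_neg (f := u)
  unfold realGrad
  rw [h, ← map_neg]
  rfl

lemma realDiv_neg (g : Metric d M) (V : ∀ x : M, TangentSpace (𝓡 d) x) (p : M) :
    realDiv g (fun x => -V x) p = -realDiv g V p := by
  have h : ∀ (i : Fin d) (q : M), coord p q (-V q) i = -coord p q (V q) i := fun i q => by
    unfold coord
    rw [map_neg]
    rfl
  unfold realDiv
  simp only [h, mul_neg, fderiv_fun_neg, neg_apply, Finset.sum_neg_distrib]

lemma div_conj (g : Metric d M) (v : CField d M) (p : M) :
    div g v.conj p = (starRingEnd ℂ) (div g v p) := by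
  simp [div, CField.conj, realDiv_neg]

/-- `g(v, v)`, with `g` extended to complex vectors conjugate-linearly in the first argument. -/
def normSq (g : Metric d M) (v : CField d M) (x : M) : ℝ :=
  g.inner x (v.re x) (v.re x) + g.inner x (v.im x) (v.im x)

variable [MeasurableSpace M]

/-- The Hilbert space `H = L²(M, μ)` of complex functions. -/
abbrev H (g : Metric d M) : Type _ := Lp ℂ 2 (riemannianMeasure g)

/-- The inner product of `H`, conjugate-linear in the first argument. -/
def innerH (g : Metric d M) (f h : M → ℂ) : ℂ :=
  ∫ x, (starRingEnd ℂ) (f x) * h x ∂(riemannianMeasure g)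

/-- `∫ g(v, v) dμ`, the square of the norm of `H_𝔛`. -/
def energy (g : Metric d M) (v : CField d M) : ℝ≥0∞ :=
  ∫⁻ x, ENNReal.ofReal (normSq g v x) ∂(riemannianMeasure g)

/-- `v` represents an element of the space `H_𝔛` of square-integrable vector fields. -/
def MemHX (g : Metric d M) (v : CField d M) : Prop :=
  v.IsMeasurable ∧ energy g v < ⊤

/-- Equality in `H_𝔛`. -/
def AEEq (g : Metric d M) (u v : CField d M) : Prop :=
  ∀ᵐ x ∂(riemannianMeasure g), u.re x = v.re x ∧ u.im x = v.im x

/-- The graph of the closure of `div : 𝔛 → C^∞(M)`, as an operator from `H_𝔛` to `H`. The fields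
`v` that occur in it are those of `H_{𝔛,div}`, and `k` is the divergence of `v`. -/
def HasDiv (g : Metric d M) (v : CField d M) (k : H g) : Prop :=
  MemHX g v ∧ ∃ V : ℕ → CField d M, (∀ n, (V n).IsSmooth) ∧
    Tendsto (fun n => energy g ((V n).sub v)) atTop (𝓝 0) ∧
    Tendsto (fun n => eLpNorm (fun x => div g (V n) x - k x) 2 (riemannianMeasure g)) atTop (𝓝 0)

/-- The Sobolev space `H¹` of functions: the domain of the closure of
`grad : C^∞(M) → 𝔛`, as an operator from `H` to `H_𝔛`. -/
def MemH1 (g : Metric d M) (k : H g) : Prop :=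
  ∃ w : CField d M, MemHX g w ∧ ∃ F : ℕ → Smooth d M,
    Tendsto (fun n => eLpNorm (fun x => (F n : M → ℂ) x - k x) 2 (riemannianMeasure g))
      atTop (𝓝 0) ∧
    Tendsto (fun n => energy g ((grad g (F n : M → ℂ)).sub w)) atTop (𝓝 0)

/-- `v` represents an element of `H^1_{𝔛,div}`: its divergence exists and lies in `H¹`. -/
def MemH1div (g : Metric d M) (v : CField d M) : Prop :=
  ∃ k : H g, HasDiv g v k ∧ MemH1 g k

lemma energy_conj_sub (g : Metric d M) (v w : CField d M) :
    energy g (v.conj.sub w.conj) = energy g (v.sub w) := by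
  have h : ∀ x, normSq g (v.conj.sub w.conj) x = normSq g (v.sub w) x := fun x => by
    have e : -v.im x - -w.im x = -(v.im x - w.im x) := by abel
    simp only [normSq, CField.conj, CField.sub, e, map_neg, neg_apply, neg_neg]
  simp only [energy, h]

lemma MemHX.conj {g : Metric d M} {v : CField d M} (hv : MemHX g v) : MemHX g v.conj := by
  refine ⟨fun p i => ⟨(hv.1 p i).1, ?_⟩, ?_⟩
  · have h := (hv.1 p i).2.neg
    convert h using 2 with x
    simp only [coord, CField.conj, map_neg, Pi.neg_apply]
    rfl
  · have h : ∀ x, normSq g v.conj x = normSq g v x := fun x => by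
      simp [normSq, CField.conj]
    simpa only [energy, h] using hv.2

lemma eLpNorm_conj_sub (g : Metric d M) (F : M → ℂ) (k : H g) :
    eLpNorm (fun x => (starRingEnd ℂ) (F x) - (star k : H g) x) 2 (riemannianMeasure g) =
      eLpNorm (fun x => F x - k x) 2 (riemannianMeasure g) := by
  refine eLpNorm_congr_norm_ae ?_
  filter_upwards [Lp.coeFn_star k] with x hx
  rw [hx, Pi.star_apply, ← starRingEnd_apply, ← map_sub]
  exact RCLike.norm_conj _

lemma HasDiv.conj {g : Metric d M} {v : CField d M} {k : H g} (h : HasDiv g v k) :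
    HasDiv g v.conj (star k) := by
  obtain ⟨hv, V, hV, h1, h2⟩ := h
  refine ⟨hv.conj, fun n => (V n).conj, fun n => ⟨(hV n).1, (hV n).2.neg_section⟩, ?_, ?_⟩
  · simpa only [energy_conj_sub] using h1
  · simpa only [div_conj, eLpNorm_conj_sub] using h2

lemma MemH1.star {g : Metric d M} {k : H g} (h : MemH1 g k) : MemH1 g (star k) := by
  obtain ⟨w, hw, F, h1, h2⟩ := h
  have hF : ∀ n, (fun x => (starRingEnd ℂ) ((F n : M → ℂ) x)) ∈ Smooth d M := fun n =>
    (ContinuousLinearMap.contMDiff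
      (Complex.conjCLE : ℂ →L[ℝ] ℂ)).comp (F n).2
  refine ⟨w.conj, hw.conj, fun n => ⟨_, hF n⟩, ?_, ?_⟩
  · simpa only [eLpNorm_conj_sub] using h1
  · have e : ∀ n, grad g (fun x => (starRingEnd ℂ) ((F n : M → ℂ) x)) =
        (grad g (F n : M → ℂ)).conj := fun n => by
      ext x
      · simp [grad, CField.conj]
      · simp [grad, CField.conj, realGrad_neg]
    simpa only [e, energy_conj_sub] using h2

/-- The space `H^1_{𝔛,div}`, through representatives of its elements: equality of elements is
equality almost everywhere, `AEEq`. -/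
def H1div (g : Metric d M) : Type _ := {v : CField d M // MemH1div g v}

/-- The conjugate `v^*` of an element of `H^1_{𝔛,div}`. -/
def H1div.conj {g : Metric d M} (v : H1div g) : H1div g :=
  ⟨v.1.conj, v.2.elim fun _ h => ⟨_, h.1.conj, h.2.star⟩⟩

end Riemannian

end SEC

end

/-!
For a smooth field `V` and a smooth function `f` one has `div (f V) = f div V + V(f)` and, by the
divergence theorem, `∫ div (f V) dμ = 0`. Both facts survive the closure. If `V n → v` in `H_𝔛` and
`div (V n) → k` in `H`, then `f V n → f v`, and `V n (f) → v(f)` in `H` because `df` is bounded on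
a compact manifold; hence `div (f v) = f k + v(f)` (`HasDiv.smul`) and `∫ (f k + v(f)) dμ = 0`
(`HasDiv.integral_mul_add_apply`). Since smooth functions separate the elements of `H`, the second
identity determines `k` (`HasDiv.unique`). Thus `A_v f = 2 v(f) + f k`, and everything can be read
off this formula: skew-adjointness is the weak identity for the function `f̄ h` (`innerH_skewOp`),
uniqueness is density of smooth functions, and `A_v 1 = k` gives back `v(f)`, which determines `v`
because there are enough cut-off coordinate functions (`aeEq_of_apply_ae_eq`).

The work lies in the divergence theorem `SmoothSection.integral_realDiv`. The supremum defining the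
Riemannian measure restricts on each chart domain to the measure `√G dy` of that chart, by the
change of variables formula (`riemannianMeasure_apply_of_subset`). In a fixed chart, `√G div V` is
a Euclidean divergence, so integration by parts holds against functions supported in the chart
(`integral_mul_chartDiv_add`). The divergence `realDiv` is computed at each point in the chart
centred there, so its independence of the chart is needed (`SmoothSection.chartDiv_eq_of_mem`); it follows
from integration by parts itself, since two continuous functions with the same integrals against
all test functions supported in the overlap agree there. A partition of unity finishes the proof.
-/

noncomputable section

namespace SEC

/-! ### Coordinate frames and components -/

section Charts

variable {d : ℕ} {M : Type*} [TopologicalSpace M] [ChartedSpace (Model d) M]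

lemma isOpen_target (p : M) : IsOpen (extChartAt (𝓡 d) p).target := isOpen_extChartAt_target p

lemma isOpen_source (p : M) : IsOpen (extChartAt (𝓡 d) p).source := isOpen_extChartAt_source p

lemma mem_chart_source {p x : M} (hx : x ∈ (extChartAt (𝓡 d) p).source) :
    x ∈ (chartAt (Model d) p).source := by rwa [extChartAt_source] at hx

section Linear

/-- The `i`-th component in the chart centred at `p`, as a linear form on the tangent space. -/
def coordL (p x : M) (i : Fin d) : TangentSpace (𝓡 d) x →L[ℝ] ℝ :=
  (EuclideanSpace.proj (𝕜 := ℝ) i : Model d →L[ℝ] ℝ).comp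
    (show TangentSpace (𝓡 d) x →L[ℝ] Model d from
      mfderiv (𝓡 d) 𝓘(ℝ, Model d) (extChartAt (𝓡 d) p) x)

lemma coord_eq_coordL (p x : M) (u : TangentSpace (𝓡 d) x) (i : Fin d) :
    coord p x u i = coordL p x i u := rfl

lemma coord_add (p x : M) (u w : TangentSpace (𝓡 d) x) (i : Fin d) :
    coord p x (u + w) i = coord p x u i + coord p x w i := map_add (coordL p x i) u w

lemma coord_smul (p x : M) (c : ℝ) (u : TangentSpace (𝓡 d) x) (i : Fin d) :
    coord p x (c • u) i = c * coord p x u i := map_smul (coordL p x i) c u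

lemma coord_sub (p x : M) (u w : TangentSpace (𝓡 d) x) (i : Fin d) :
    coord p x (u - w) i = coord p x u i - coord p x w i := map_sub (coordL p x i) u w

end Linear

variable [IsManifold (𝓡 d) ∞ M]

/-- The coordinate vector `∂_i` of the chart centred at `p`, as a section over the domain of that
chart, given by the trivialization of the tangent bundle at `p`. Unlike `coordVec`, it is indexed
by the point of the manifold. -/
def frame (p : M) (i : Fin d) (x : M) : TangentSpace (𝓡 d) x :=
  (trivializationAt (Model d) (TangentSpace (𝓡 d)) p).symmL ℝ x (EuclideanSpace.single i (1 : ℝ))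

lemma coord_eq {p x : M} (hx : x ∈ (extChartAt (𝓡 d) p).source) (u : TangentSpace (𝓡 d) x)
    (i : Fin d) : coord p x u i =
      (trivializationAt (Model d) (TangentSpace (𝓡 d)) p).continuousLinearMapAt ℝ x u i := by
  rw [TangentBundle.continuousLinearMapAt_trivializationAt (mem_chart_source hx)]
  rfl

lemma sum_coord_smul_frame {p x : M} (hx : x ∈ (extChartAt (𝓡 d) p).source)
    (u : TangentSpace (𝓡 d) x) : ∑ i, coord p x u i • frame p i x = u := by
  have h := (trivializationAt (Model d) (TangentSpace (𝓡 d)) p).symmL_continuousLinearMapAt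
    (R := ℝ) (b := x) (mem_chart_source hx) u
  conv_rhs => rw [← h]
  have e : (trivializationAt (Model d) (TangentSpace (𝓡 d)) p).continuousLinearMapAt ℝ x u =
      ∑ i, coord p x u i • EuclideanSpace.single i (1 : ℝ) := by
    ext j
    rw [← coord_eq hx]
    simp [Pi.single_apply]
  rw [e, map_sum]
  simp only [map_smul, frame]

lemma coord_frame {p x : M} (hx : x ∈ (extChartAt (𝓡 d) p).source) (i j : Fin d) :
    coord p x (frame p i x) j = if j = i then 1 else 0 := by
  rw [coord_eq hx, frame, (trivializationAt (Model d) (TangentSpace (𝓡 d))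
    p).continuousLinearMapAt_symmL (R := ℝ) (b := x) (mem_chart_source hx)]
  simp

lemma coordVec_eq_frame {p : M} {y : Model d} (hy : y ∈ (extChartAt (𝓡 d) p).target) (i : Fin d) :
    coordVec p y i = frame p i ((extChartAt (𝓡 d) p).symm y) := by
  have hx := (extChartAt (𝓡 d) p).map_target hy
  rw [frame, TangentBundle.symmL_trivializationAt (mem_chart_source hx),
    (extChartAt (𝓡 d) p).right_inv hy]
  rw [show Set.range (𝓡 d) = Set.univ by simp, mfderivWithin_univ]
  rfl

/-- The derivative `df(u)` of a function `f` with values in a normed space along a tangent vector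
`u` at `x`. -/
def dirDeriv {F : Type*} [NormedAddCommGroup F] [NormedSpace ℝ F] (f : M → F) (x : M)
    (u : TangentSpace (𝓡 d) x) : F :=
  mfderiv (𝓡 d) 𝓘(ℝ, F) f x u

/-- The chain rule in a chart: `df(u) = ∑ i, u^i ∂_i f`. -/
lemma dirDeriv_eq_sum {F : Type*} [NormedAddCommGroup F] [NormedSpace ℝ F] {f : M → F} {p x : M}
    (hx : x ∈ (extChartAt (𝓡 d) p).source) (hf : MDifferentiableAt (𝓡 d) 𝓘(ℝ, F) f x)
    (u : TangentSpace (𝓡 d) x) :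
    dirDeriv f x u = ∑ i, coord p x u i •
      fderiv ℝ (f ∘ (extChartAt (𝓡 d) p).symm) (extChartAt (𝓡 d) p x)
        (EuclideanSpace.single i (1 : ℝ)) := by
  have hy := (extChartAt (𝓡 d) p).map_source hx
  have hxy := (extChartAt (𝓡 d) p).left_inv hx
  have hs : MDifferentiableAt 𝓘(ℝ, Model d) (𝓡 d) (extChartAt (𝓡 d) p).symm
      (extChartAt (𝓡 d) p x) :=
    ((contMDiffOn_extChartAt_symm (n := ∞) p).contMDiffAt
      ((isOpen_target p).mem_nhds hy)).mdifferentiableAt (by simp)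
  have hf' : MDifferentiableAt (𝓡 d) 𝓘(ℝ, F) f
      ((extChartAt (𝓡 d) p).symm (extChartAt (𝓡 d) p x)) := by rwa [hxy]
  have key : ∀ i, fderiv ℝ (f ∘ (extChartAt (𝓡 d) p).symm) (extChartAt (𝓡 d) p x)
        (EuclideanSpace.single i (1 : ℝ)) =
      dirDeriv f x (frame p i x) := by
    intro i
    rw [← mfderiv_eq_fderiv, mfderiv_comp _ hf' hs]
    have h2 := coordVec_eq_frame hy i
    change dirDeriv f ((extChartAt (𝓡 d) p).symm (extChartAt (𝓡 d) p x)) (coordVec p _ i) = _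
    rw [h2]
    exact congrArg (fun z => dirDeriv f z (frame p i z)) hxy
  simp only [key]
  conv_lhs => rw [← sum_coord_smul_frame hx u]
  unfold dirDeriv
  rw [map_sum]
  simp only [map_smul]
  rfl

lemma contMDiffOn_frame (p : M) (i : Fin d) :
    ContMDiffOn (𝓡 d) (𝓡 d).tangent ∞
      (fun x => (⟨x, frame p i x⟩ : TangentBundle (𝓡 d) M)) (extChartAt (𝓡 d) p).source := by
  rw [extChartAt_source]
  refine ((trivializationAt (Model d) (TangentSpace (𝓡 d)) p).contMDiffOn_section_iff (n := ∞)
    (chartAt (Model d) p).open_source (by simp)).2 ?_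
  refine (contMDiffOn_const (c := EuclideanSpace.single i (1 : ℝ))).congr fun x hx => ?_
  have h := (trivializationAt (Model d) (TangentSpace (𝓡 d)) p).continuousLinearMapAt_symmL (R := ℝ)
    (b := x) hx (EuclideanSpace.single i (1 : ℝ))
  rw [Bundle.Trivialization.continuousLinearMapAt_apply,
    Bundle.Trivialization.coe_linearMapAt_of_mem _ hx] at h
  exact h

lemma contMDiffOn_coord {V : ∀ x : M, TangentSpace (𝓡 d) x} {s : Set M}
    (p : M) (hs : IsOpen s) (hsp : s ⊆ (extChartAt (𝓡 d) p).source)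
    (hV : ContMDiffOn (𝓡 d) (𝓡 d).tangent ∞
      (fun x => (⟨x, V x⟩ : TangentBundle (𝓡 d) M)) s) (i : Fin d) :
    ContMDiffOn (𝓡 d) 𝓘(ℝ, ℝ) ∞ (fun x => coord p x (V x) i) s := by
  have h := ((trivializationAt (Model d) (TangentSpace (𝓡 d)) p).contMDiffOn_section_iff (n := ∞)
    hs (fun x hx => mem_chart_source (hsp hx))).1 hV
  have h2 := (EuclideanSpace.proj (𝕜 := ℝ) i : Model d →L[ℝ] ℝ).contMDiff (n := ∞)
    |>.comp_contMDiffOn h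
  refine h2.congr fun x hx => ?_
  rw [coord_eq (hsp hx), Bundle.Trivialization.continuousLinearMapAt_apply,
    Bundle.Trivialization.coe_linearMapAt_of_mem _ (mem_chart_source (hsp hx))]
  rfl

/-- `√(det (g_ij))` in the chart centred at `p`, as a function on the manifold. -/
def density (g : Metric d M) (p x : M) : ℝ :=
  √(Matrix.det (Matrix.of fun i j => g.inner x (frame p i x) (frame p j x)))

lemma volDensity_eq_density (g : Metric d M) {p : M} {y : Model d}
    (hy : y ∈ (extChartAt (𝓡 d) p).target) :
    volDensity g p y = density g p ((extChartAt (𝓡 d) p).symm y) := by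
  simp only [volDensity, density, coordVec_eq_frame hy]

lemma gram_posDef (g : Metric d M) {p x : M} (hx : x ∈ (extChartAt (𝓡 d) p).source) :
    (Matrix.of fun i j => g.inner x (frame p i x) (frame p j x)).PosDef := by
  refine Matrix.PosDef.of_dotProduct_mulVec_pos ?_ fun c hc => ?_
  · ext i j
    simp [g.symm x]
  · have h0 : ∑ i, c i • frame p i x ≠ 0 := by
      intro h
      apply hc
      ext j
      have h1 := congrArg (coordL p x j) h
      simp only [map_sum, map_smul, map_zero, ← coord_eq_coordL] at h1
      simpa [coord_frame hx] using h1
    have h := g.pos x _ h0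
    refine h.trans_eq (Eq.symm ?_)
    simp only [dotProduct, Matrix.mulVec, Finset.mul_sum, map_sum, map_smul, sum_apply,
      smul_apply, smul_eq_mul, Matrix.of_apply, star_trivial]
    rw [Finset.sum_comm]
    exact Finset.sum_congr rfl fun i _ => Finset.sum_congr rfl fun j _ => by ring

lemma density_pos (g : Metric d M) {p x : M} (hx : x ∈ (extChartAt (𝓡 d) p).source) :
    0 < density g p x := Real.sqrt_pos.2 (gram_posDef g hx).det_pos

open Bundle in
lemma contMDiffOn_inner_frame (g : Metric d M) (p : M) (i j : Fin d) :
    ContMDiffOn (𝓡 d) 𝓘(ℝ, ℝ) ∞ (fun x => g.inner x (frame p i x) (frame p j x))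
      (extChartAt (𝓡 d) p).source := by
  let _ : Bundle.RiemannianBundle (fun x : M => TangentSpace (𝓡 d) x) := ⟨g.toRiemannianMetric⟩
  exact ContMDiffOn.inner_bundle (contMDiffOn_frame p i) (contMDiffOn_frame p j)

lemma contMDiffOn_density (g : Metric d M) (p : M) :
    ContMDiffOn (𝓡 d) 𝓘(ℝ, ℝ) ∞ (density g p) (extChartAt (𝓡 d) p).source := by
  intro x hx
  have hdet : ContMDiffWithinAt (𝓡 d) 𝓘(ℝ, ℝ) ∞ (fun x => Matrix.det (Matrix.of fun i j =>
      g.inner x (frame p i x) (frame p j x))) (extChartAt (𝓡 d) p).source x := by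
    simp only [Matrix.det_apply, Matrix.of_apply]
    refine ContMDiffWithinAt.sum fun σ _ => ?_
    simp only [Units.smul_def, zsmul_eq_mul]
    refine contMDiffWithinAt_const.mul ?_
    exact contMDiffWithinAt_finsetProd fun i _ => contMDiffOn_inner_frame g p _ _ x hx
  exact ((Real.contDiffAt_sqrt (n := ∞)
    (gram_posDef g hx).det_pos.ne').contMDiffAt.comp_contMDiffWithinAt x hdet)

end Charts

/-! ### The Riemannian measure in charts -/

section Volume

variable {d : ℕ} {M : Type*} [TopologicalSpace M] [ChartedSpace (Model d) M]

/-- A family of measures living on sets that cover the space, and agreeing on overlaps, has a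
supremum that restricts to each member of the family. -/
lemma iSup_measure_apply_of_agree {X ι : Type*} [MeasurableSpace X] {m : ι → Measure X}
    {S : ι → Set X} (hS : ∀ i, MeasurableSet (S i)) (hm : ∀ i, m i (S i)ᶜ = 0)
    (hagree : ∀ i j s, MeasurableSet s → s ⊆ S i → s ⊆ S j → m i s = m j s)
    {p : ℕ → ι} (hp : ⋃ n, S (p n) = Set.univ) {j : ι} {s : Set X} (hs : MeasurableSet s)
    (hsj : s ⊆ S j) : (⨆ i, m i) s = m j s := by
  -- the measure glued from the pieces on the disjointed cover bounds the whole family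
  let D : ℕ → Set X := disjointed fun n => S (p n)
  have hD : ∀ n, MeasurableSet (D n) := MeasurableSet.disjointed fun n => hS (p n)
  let ν : Measure X := Measure.sum fun n => (m (p n)).restrict (D n)
  have hν : ∀ (i : ι) (t : Set X), MeasurableSet t → t ⊆ S i → ν t = m i t := by
    intro i t ht hti
    have h1 : ∀ n, (m (p n)).restrict (D n) t = m i (t ∩ D n) := fun n => by
      rw [Measure.restrict_apply ht]
      exact hagree _ _ _ (ht.inter (hD n))
        (Set.inter_subset_right.trans (disjointed_subset _ n))
        (Set.inter_subset_left.trans hti)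
    rw [Measure.sum_apply _ ht]
    simp only [h1]
    rw [← measure_iUnion, ← Set.inter_iUnion]
    · change m i (t ∩ ⋃ n, disjointed (fun n => S (p n)) n) = m i t
      rw [iUnion_disjointed, hp, Set.inter_univ]
    · exact fun a b hab => ((disjoint_disjointed fun n => S (p n)) hab).mono
        Set.inter_subset_right Set.inter_subset_right
    · exact fun n => ht.inter (hD n)
  have hle : ⨆ i, m i ≤ ν := by
    refine iSup_le fun i => Measure.le_iff.2 fun t ht => ?_
    calc m i t ≤ m i (t ∩ S i) + m i (S i)ᶜ :=
          (measure_mono fun x hx => by by_cases h : x ∈ S i <;> simp [h, hx]).trans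
            (measure_union_le _ _)
      _ = ν (t ∩ S i) := by
          rw [hm, add_zero, hν i _ (ht.inter (hS i)) Set.inter_subset_right]
      _ ≤ ν t := measure_mono Set.inter_subset_left
  refine le_antisymm ((hle s).trans_eq (hν j s hs hsj)) ?_
  exact (le_iSup m j) s

/-- The change of coordinates from the chart centred at `p` to the chart centred at `q`. -/
def transition (p q : M) : Model d → Model d := extChartAt (𝓡 d) q ∘ (extChartAt (𝓡 d) p).symm

lemma measurableSet_target_inter_preimage [MeasurableSpace M] [BorelSpace M] (p : M) {s : Set M} (hs : MeasurableSet s) :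
    MeasurableSet ((extChartAt (𝓡 d) p).target ∩ (extChartAt (𝓡 d) p).symm ⁻¹' s) := by
  have h := ((continuousOn_extChartAt_symm (I := 𝓡 d) p).domRestrict.measurable hs)
  rw [show (extChartAt (𝓡 d) p).target ∩ (extChartAt (𝓡 d) p).symm ⁻¹' s = Subtype.val ''
    ((extChartAt (𝓡 d) p).target.domRestrict (extChartAt (𝓡 d) p).symm ⁻¹' s) by
      ext y; simp [Set.domRestrict, and_comm]]
  exact (isOpen_target (d := d) p).measurableSet.subtype_image h

lemma aemeasurable_extChartAt_symm [MeasurableSpace M] [BorelSpace M] (p : M) :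
    AEMeasurable (extChartAt (𝓡 d) p).symm
      ((volume : Measure (Model d)).restrict (extChartAt (𝓡 d) p).target) :=
  (continuousOn_extChartAt_symm p).aemeasurable (isOpen_target p).measurableSet

variable [IsManifold (𝓡 d) ∞ M]

lemma differentiableAt_transition {p q x : M} (hp : x ∈ (extChartAt (𝓡 d) p).source)
    (hq : x ∈ (extChartAt (𝓡 d) q).source) :
    DifferentiableAt ℝ (transition p q) (extChartAt (𝓡 d) p x) := by
  have hy := (extChartAt (𝓡 d) p).map_source hp
  have hxy := (extChartAt (𝓡 d) p).left_inv hp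
  have h1 := ((contMDiffOn_extChartAt_symm (n := ∞) p).contMDiffAt
    ((isOpen_target p).mem_nhds hy))
  have h2 : ContMDiffAt (𝓡 d) 𝓘(ℝ, Model d) ∞ (extChartAt (𝓡 d) q)
      ((extChartAt (𝓡 d) p).symm (extChartAt (𝓡 d) p x)) := by
    rw [hxy]
    exact contMDiffAt_extChartAt' (mem_chart_source hq)
  exact (h2.comp _ h1).contDiffAt.differentiableAt (by simp)

/-- The Jacobian matrix of a change of coordinates consists of the components of the first frame
in the second. -/
lemma fderiv_transition {p q x : M} (hp : x ∈ (extChartAt (𝓡 d) p).source)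
    (hq : x ∈ (extChartAt (𝓡 d) q).source) (i k : Fin d) :
    fderiv ℝ (transition p q) (extChartAt (𝓡 d) p x) (EuclideanSpace.single i (1 : ℝ)) k =
      coord q x (frame p i x) k := by
  have h := dirDeriv_eq_sum hp
    ((contMDiffAt_extChartAt' (I := 𝓡 d) (n := ∞) (mem_chart_source hq)).mdifferentiableAt
      (by simp)) (frame p i x)
  simp only [coord_frame hp, ite_smul, one_smul, zero_smul, Finset.sum_ite_eq',
    Finset.mem_univ, if_true] at h
  exact (congrArg (fun v : Model d => v k) h).symm

/-- `√G` transforms as a density, since the Gram matrices satisfy `G_p = Jᵀ G_q J`. -/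
lemma density_transition (g : Metric d M) {p q x : M} (hp : x ∈ (extChartAt (𝓡 d) p).source)
    (hq : x ∈ (extChartAt (𝓡 d) q).source) :
    density g p x =
      |(fderiv ℝ (transition p q) (extChartAt (𝓡 d) p x)).det| * density g q x := by
  set J : Matrix (Fin d) (Fin d) ℝ := Matrix.of fun k i => coord q x (frame p i x) k with hJ
  have hdet : (fderiv ℝ (transition p q) (extChartAt (𝓡 d) p x)).det = J.det := by
    rw [ContinuousLinearMap.det,
      ← LinearMap.det_toMatrix (EuclideanSpace.basisFun (Fin d) ℝ).toBasis]
    congr 1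
    ext k i
    rw [LinearMap.toMatrix_apply]
    simpa [hJ] using fderiv_transition hp hq i k
  have hgram : (Matrix.of fun i j => g.inner x (frame p i x) (frame p j x)) =
      J.transpose * (Matrix.of fun i j => g.inner x (frame q i x) (frame q j x)) * J := by
    ext i j
    conv_lhs => rw [Matrix.of_apply, ← sum_coord_smul_frame hq (frame p i x),
      ← sum_coord_smul_frame hq (frame p j x)]
    simp only [map_sum, map_smul, sum_apply, smul_apply, smul_eq_mul, Matrix.mul_apply,
      Matrix.transpose_apply, hJ, Matrix.of_apply, Finset.sum_mul, Finset.mul_sum]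
    exact Finset.sum_congr rfl fun k _ => Finset.sum_congr rfl fun l _ => by ring
  rw [density, density, hgram, Matrix.det_mul, Matrix.det_mul, Matrix.det_transpose, hdet,
    show J.det * Matrix.det (Matrix.of fun i j => g.inner x (frame q i x) (frame q j x)) * J.det =
      J.det ^ 2 * Matrix.det (Matrix.of fun i j => g.inner x (frame q i x) (frame q j x)) by ring,
    Real.sqrt_mul (sq_nonneg _), Real.sqrt_sq_eq_abs]

lemma continuousOn_volDensity (g : Metric d M) (p : M) :
    ContinuousOn (volDensity g p) (extChartAt (𝓡 d) p).target :=
  ((contMDiffOn_density g p).continuousOn.comp (continuousOn_extChartAt_symm p)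
    fun _ hy => (extChartAt (𝓡 d) p).map_target hy).congr fun _ hy => volDensity_eq_density g hy

variable [MeasurableSpace M] [BorelSpace M]

lemma chartMeasure_apply (g : Metric d M) (p : M) {s : Set M} (hs : MeasurableSet s) :
    chartMeasure g p s = ∫⁻ y in (extChartAt (𝓡 d) p).target ∩ (extChartAt (𝓡 d) p).symm ⁻¹' s,
      ENNReal.ofReal (density g p ((extChartAt (𝓡 d) p).symm y)) := by
  have hA := measurableSet_target_inter_preimage (d := d) p hs
  have hT := (isOpen_target (d := d) p).measurableSet
  rw [chartMeasure, Measure.map_apply_of_aemeasurable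
    ((aemeasurable_extChartAt_symm p).mono_ac (withDensity_absolutelyContinuous _ _)) hs,
    withDensity_apply', Measure.restrict_restrict₀' hT.nullMeasurableSet, Set.inter_comm]
  refine setLIntegral_congr_fun hA fun y hy => ?_
  rw [volDensity_eq_density g hy.1]

lemma integral_chartMeasure {E : Type*} [NormedAddCommGroup E] [NormedSpace ℝ E]
    (g : Metric d M) (p : M) {F : M → E} (hF : AEStronglyMeasurable F (chartMeasure g p)) :
    ∫ x, F x ∂(chartMeasure g p) = ∫ y in (extChartAt (𝓡 d) p).target,
      volDensity g p y • F ((extChartAt (𝓡 d) p).symm y) := by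
  have hT := (isOpen_target (d := d) p).measurableSet
  rw [chartMeasure, integral_map
    ((aemeasurable_extChartAt_symm p).mono_ac (withDensity_absolutelyContinuous _ _)) hF,
    integral_withDensity_eq_integral_toReal_smul₀ _ (by simp)]
  · refine setIntegral_congr_fun hT fun y hy => ?_
    rw [ENNReal.toReal_ofReal (show 0 ≤ volDensity g p y from Real.sqrt_nonneg _)]
  · exact ((continuousOn_volDensity g p).aemeasurable hT).ennreal_ofReal

/-- The measures of two charts agree on their overlap, by the change of variables formula. -/
lemma chartMeasure_eq_of_subset (g : Metric d M) {p q : M} {s : Set M} (hs : MeasurableSet s)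
    (hp : s ⊆ (extChartAt (𝓡 d) p).source) (hq : s ⊆ (extChartAt (𝓡 d) q).source) :
    chartMeasure g p s = chartMeasure g q s := by
  set A := (extChartAt (𝓡 d) p).target ∩ (extChartAt (𝓡 d) p).symm ⁻¹' s with hAdef
  have hA : MeasurableSet A := measurableSet_target_inter_preimage p hs
  have himage : (extChartAt (𝓡 d) q).target ∩ (extChartAt (𝓡 d) q).symm ⁻¹' s =
      transition p q '' A := by
    ext z
    constructor
    · rintro ⟨hz, hzs⟩
      refine ⟨extChartAt (𝓡 d) p ((extChartAt (𝓡 d) q).symm z),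
        ⟨(extChartAt (𝓡 d) p).map_source (hp hzs), ?_⟩, ?_⟩
      · rw [Set.mem_preimage, (extChartAt (𝓡 d) p).left_inv (hp hzs)]
        exact hzs
      · rw [transition, Function.comp_apply, (extChartAt (𝓡 d) p).left_inv (hp hzs),
          (extChartAt (𝓡 d) q).right_inv hz]
    · rintro ⟨y, ⟨hy, hys⟩, rfl⟩
      refine ⟨(extChartAt (𝓡 d) q).map_source (hq hys), ?_⟩
      rw [Set.mem_preimage, transition, Function.comp_apply,
        (extChartAt (𝓡 d) q).left_inv (hq hys)]
      exact hys
  have hinj : Set.InjOn (transition p q) A := by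
    intro y hy z hz h
    have h' := (extChartAt (𝓡 d) q).injOn (hq hy.2) (hq hz.2) h
    exact (extChartAt (𝓡 d) p).symm.injOn hy.1 hz.1 h'
  have hder : ∀ y ∈ A, HasFDerivWithinAt (transition p q) (fderiv ℝ (transition p q) y) A y := by
    intro y hy
    have h := differentiableAt_transition (hp hy.2) (hq hy.2)
    rw [(extChartAt (𝓡 d) p).right_inv hy.1] at h
    exact h.hasFDerivAt.hasFDerivWithinAt
  rw [chartMeasure_apply g p hs, chartMeasure_apply g q hs, himage,
    lintegral_image_eq_lintegral_abs_det_fderiv_mul volume hA hder hinj]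
  refine setLIntegral_congr_fun hA fun y hy => ?_
  have h := density_transition g (hp hy.2) (hq hy.2)
  rw [(extChartAt (𝓡 d) p).right_inv hy.1] at h
  rw [h, ENNReal.ofReal_mul (abs_nonneg _), transition, Function.comp_apply,
    (extChartAt (𝓡 d) q).left_inv (hq hy.2)]

/-- The Riemannian measure restricts to the measure of each chart. -/
lemma riemannianMeasure_apply_of_subset [CompactSpace M] (g : Metric d M) {p : M} {s : Set M}
    (hs : MeasurableSet s) (hp : s ⊆ (extChartAt (𝓡 d) p).source) :
    riemannianMeasure g s = chartMeasure g p s := by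
  obtain ⟨c, hc, hcov⟩ := countable_cover_nhds_of_sigmaCompact
    fun x : M => extChartAt_source_mem_nhds (I := 𝓡 d) x
  have hne : c.Nonempty := by
    by_contra h
    rw [Set.not_nonempty_iff_eq_empty.1 h] at hcov
    simpa using (hcov.symm ▸ Set.mem_univ p : p ∈ ⋃ x ∈ (∅ : Set M), (extChartAt (𝓡 d) x).source)
  obtain ⟨u, rfl⟩ := hc.exists_eq_range hne
  refine iSup_measure_apply_of_agree (S := fun q => (extChartAt (𝓡 d) q).source) (p := u)
    (fun q => (isOpen_source q).measurableSet) (fun q => ?_)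
    (fun i j t ht hi hj => chartMeasure_eq_of_subset g ht hi hj) (by simpa using hcov) hs hp
  rw [chartMeasure_apply g q (isOpen_source q).measurableSet.compl]
  convert lintegral_zero_measure _
  rw [Measure.restrict_eq_zero]
  convert measure_empty (μ := (volume : Measure (Model d)))
  ext y
  simp only [Set.mem_inter_iff, Set.mem_preimage, Set.mem_compl_iff, Set.mem_empty_iff_false,
    iff_false, not_and, not_not]
  exact fun hy => (extChartAt (𝓡 d) q).map_target hy

lemma riemannianMeasure_restrict_source [CompactSpace M] (g : Metric d M) (p : M) :
    (riemannianMeasure g).restrict (extChartAt (𝓡 d) p).source =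
      (chartMeasure g p).restrict (extChartAt (𝓡 d) p).source := by
  ext s hs
  have hS := (isOpen_source (d := d) p).measurableSet
  rw [Measure.restrict_apply hs, Measure.restrict_apply hs,
    riemannianMeasure_apply_of_subset g (hs.inter hS) Set.inter_subset_right]

/-- Nonempty open sets have positive Riemannian measure. -/
instance [CompactSpace M] (g : Metric d M) : (riemannianMeasure g).IsOpenPosMeasure := by
  refine ⟨fun U hU ⟨x, hx⟩ h0 => ?_⟩
  have hV : IsOpen (U ∩ (extChartAt (𝓡 d) x).source) := hU.inter (isOpen_source x)
  have h1 : chartMeasure g x (U ∩ (extChartAt (𝓡 d) x).source) = 0 := by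
    rw [← riemannianMeasure_apply_of_subset g hV.measurableSet Set.inter_subset_right]
    exact measure_mono_null Set.inter_subset_left h0
  have hA : IsOpen ((extChartAt (𝓡 d) x).target ∩ (extChartAt (𝓡 d) x).symm ⁻¹'
      (U ∩ (extChartAt (𝓡 d) x).source)) :=
    (continuousOn_extChartAt_symm x).isOpen_inter_preimage (isOpen_target x) hV
  rw [chartMeasure_apply g x hV.measurableSet, setLIntegral_eq_zero_iff' hA.measurableSet] at h1
  · have h2 : volume ((extChartAt (𝓡 d) x).target ∩ (extChartAt (𝓡 d) x).symm ⁻¹'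
        (U ∩ (extChartAt (𝓡 d) x).source)) = 0 := by
      refine measure_mono_null (fun y hy => ?_) h1
      simp only [Set.mem_compl_iff, Set.mem_ofPred_eq, Classical.not_imp]
      exact ⟨hy, by simpa using density_pos g hy.2.2⟩
    have hne : ((extChartAt (𝓡 d) x).target ∩ (extChartAt (𝓡 d) x).symm ⁻¹'
        (U ∩ (extChartAt (𝓡 d) x).source)).Nonempty := by
      refine ⟨extChartAt (𝓡 d) x x, mem_extChartAt_target x, ?_⟩
      rw [Set.mem_preimage, extChartAt_to_inv]
      exact ⟨hx, mem_extChartAt_source x⟩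
    exact (hA.measure_pos volume hne).ne' h2
  · refine (ContinuousOn.aemeasurable ?_ hA.measurableSet).ennreal_ofReal
    exact ((contMDiffOn_density g x).continuousOn.comp (continuousOn_extChartAt_symm x)
      fun _ hy => (extChartAt (𝓡 d) x).map_target hy).mono Set.inter_subset_left

end Volume

/-! ### The divergence theorem -/

section Divergence

variable {d : ℕ} {M : Type*} [TopologicalSpace M] [ChartedSpace (Model d) M]

section Calculus

variable {F : Type*} [NormedAddCommGroup F] [NormedSpace ℝ F]

lemma dirDeriv_sub_vec (f : M → F) (x : M) (u w : TangentSpace (𝓡 d) x) :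
    dirDeriv f x (u - w) = dirDeriv f x u - dirDeriv f x w := map_sub _ u w

lemma dirDeriv_neg_vec (f : M → F) (x : M) (u : TangentSpace (𝓡 d) x) :
    dirDeriv f x (-u) = -dirDeriv f x u := map_neg _ u

lemma dirDeriv_const (a : F) (x : M) (u : TangentSpace (𝓡 d) x) :
    dirDeriv (fun _ : M => a) x u = 0 := by
  unfold dirDeriv
  rw [mfderiv_const]
  rfl

lemma dirDeriv_comp_clm {F' : Type*} [NormedAddCommGroup F'] [NormedSpace ℝ F'] (L : F →L[ℝ] F')
    {f : M → F} {x : M} (hf : MDifferentiableAt (𝓡 d) 𝓘(ℝ, F) f x) (u : TangentSpace (𝓡 d) x) :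
    dirDeriv (fun z => L (f z)) x u = L (dirDeriv f x u) := by
  have h := (L.hasFDerivAt (x := f x)).hasMFDerivAt.comp x hf.hasMFDerivAt
  unfold dirDeriv
  rw [show (fun z => L (f z)) = L ∘ f from rfl, h.mfderiv]
  rfl

lemma dirDeriv_add {f h : M → F} {x : M} (hf : MDifferentiableAt (𝓡 d) 𝓘(ℝ, F) f x)
    (hh : MDifferentiableAt (𝓡 d) 𝓘(ℝ, F) h x) (u : TangentSpace (𝓡 d) x) :
    dirDeriv (fun z => f z + h z) x u = dirDeriv f x u + dirDeriv h x u := by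
  have e := (hf.hasMFDerivAt.add hh.hasMFDerivAt).mfderiv
  unfold dirDeriv
  rw [show (fun z => f z + h z) = f + h from rfl, e]
  rfl

lemma dirDeriv_mul {A : Type*} [NormedCommRing A] [NormedAlgebra ℝ A] {f h : M → A} {x : M}
    (hf : MDifferentiableAt (𝓡 d) 𝓘(ℝ, A) f x) (hh : MDifferentiableAt (𝓡 d) 𝓘(ℝ, A) h x)
    (u : TangentSpace (𝓡 d) x) :
    dirDeriv (fun z => f z * h z) x u = f x * dirDeriv h x u + h x * dirDeriv f x u := by
  have e := (hf.hasMFDerivAt.mul hh.hasMFDerivAt).mfderiv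
  unfold dirDeriv
  rw [show (fun z => f z * h z) = f * h from rfl, e]
  rfl

lemma dirDeriv_eq_zero_of_notMem_tsupport {f : M → F} {x : M} (hx : x ∉ tsupport f)
    (u : TangentSpace (𝓡 d) x) : dirDeriv f x u = 0 := by
  have h : f =ᶠ[𝓝 x] fun _ => 0 := notMem_tsupport_iff_eventuallyEq.1 hx
  unfold dirDeriv
  rw [h.mfderiv_eq, mfderiv_const]
  rfl

lemma sum_dirDeriv {n : ℕ} {f : Fin n → M → F} {x : M}
    (hf : ∀ i, MDifferentiableAt (𝓡 d) 𝓘(ℝ, F) (f i) x) (u : TangentSpace (𝓡 d) x) :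
    ∑ i, dirDeriv (f i) x u = dirDeriv (fun z => ∑ i, f i z) x u := by
  let D : Fin n → TangentSpace (𝓡 d) x →L[ℝ] F := fun i => mfderiv (𝓡 d) 𝓘(ℝ, F) (f i) x
  have e := (HasMFDerivAt.sum (t := Finset.univ) (f' := D) fun i _ => (hf i).hasMFDerivAt).mfderiv
  rw [show (fun z => ∑ i, f i z) = ∑ i, f i by ext z; simp]
  refine Eq.trans ?_ (congrArg (fun L : TangentSpace (𝓡 d) x →L[ℝ] F => L u) e).symm
  exact (sum_apply Finset.univ D u).symm

end Calculus

variable [IsManifold (𝓡 d) ∞ M]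

/-- A smooth section of the real tangent bundle. -/
def SmoothSection (V : ∀ x : M, TangentSpace (𝓡 d) x) : Prop :=
  ContMDiff (𝓡 d) (𝓡 d).tangent ∞ (fun x => (⟨x, V x⟩ : TangentBundle (𝓡 d) M))

lemma contDiffOn_comp_symm {F : Type*} [NormedAddCommGroup F] [NormedSpace ℝ F] {f : M → F} {p : M}
    (hf : ContMDiffOn (𝓡 d) 𝓘(ℝ, F) ∞ f (extChartAt (𝓡 d) p).source) :
    ContDiffOn ℝ ∞ (f ∘ (extChartAt (𝓡 d) p).symm) (extChartAt (𝓡 d) p).target :=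
  (hf.comp (contMDiffOn_extChartAt_symm p)
    fun _ hy => (extChartAt (𝓡 d) p).map_target hy).contDiffOn

lemma SmoothSection.continuous_dirDeriv {F : Type*} [NormedAddCommGroup F] [NormedSpace ℝ F]
    {V : ∀ x : M, TangentSpace (𝓡 d) x} (hV : SmoothSection V) {f : M → F}
    (hf : ContMDiff (𝓡 d) 𝓘(ℝ, F) ∞ f) : Continuous fun x => dirDeriv f x (V x) := by
  refine continuous_iff_continuousAt.2 fun p => ?_
  have hcont : ContinuousOn (fun x => dirDeriv f x (V x)) (extChartAt (𝓡 d) p).source := by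
    have h1 : ∀ i, ContinuousOn (fun x => coord p x (V x) i) (extChartAt (𝓡 d) p).source :=
      fun i => (contMDiffOn_coord p (isOpen_source p) subset_rfl hV.contMDiffOn i).continuousOn
    have h2 := ((contDiffOn_comp_symm (p := p) hf.contMDiffOn).continuousOn_fderiv_of_isOpen
      (isOpen_target p) (by simp)).comp (continuousOn_extChartAt p)
        fun _ hx => (extChartAt (𝓡 d) p).map_source hx
    refine (continuousOn_finsetSum Finset.univ fun i _ =>
      (h1 i).smul (h2.clm_apply (continuousOn_const
        (c := EuclideanSpace.single i (1 : ℝ))))).congr fun x hx => ?_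
    exact dirDeriv_eq_sum hx (hf.mdifferentiableAt (by simp)) (V x)
  exact hcont.continuousAt ((isOpen_source p).mem_nhds (mem_extChartAt_source p))

/-- The function `√G V^i` on the image of the chart centred at `p`. -/
def fluxComp (g : Metric d M) (p : M) (V : ∀ x : M, TangentSpace (𝓡 d) x) (i : Fin d)
    (y : Model d) : ℝ :=
  volDensity g p y * coord p ((extChartAt (𝓡 d) p).symm y) (V ((extChartAt (𝓡 d) p).symm y)) i

/-- The divergence `(1/√G) ∑ i, ∂_i (√G V^i)` of a real vector field, computed at `x` in the fixed
chart centred at `p`; `realDiv` takes `p = x`. -/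
def chartDiv (g : Metric d M) (p : M) (V : ∀ x : M, TangentSpace (𝓡 d) x) (x : M) : ℝ :=
  (volDensity g p (extChartAt (𝓡 d) p x))⁻¹ *
    ∑ i : Fin d, fderiv ℝ (fluxComp g p V i) (extChartAt (𝓡 d) p x)
      (EuclideanSpace.single i (1 : ℝ))

lemma realDiv_eq_chartDiv (g : Metric d M) (V : ∀ x : M, TangentSpace (𝓡 d) x) (x : M) :
    realDiv g V x = chartDiv g x V x := rfl

lemma volDensity_pos (g : Metric d M) {p : M} {y : Model d}
    (hy : y ∈ (extChartAt (𝓡 d) p).target) : 0 < volDensity g p y := by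
  rw [volDensity_eq_density g hy]
  exact density_pos g ((extChartAt (𝓡 d) p).map_target hy)

lemma SmoothSection.contDiffOn_fluxComp (g : Metric d M) (p : M)
    {V : ∀ x : M, TangentSpace (𝓡 d) x} (hV : SmoothSection V) (i : Fin d) :
    ContDiffOn ℝ ∞ (fluxComp g p V i) (extChartAt (𝓡 d) p).target :=
  (contDiffOn_comp_symm ((contMDiffOn_density g p).mul
    (contMDiffOn_coord p (isOpen_source p) subset_rfl hV.contMDiffOn i))).congr
      fun y hy => by
        rw [fluxComp, volDensity_eq_density g hy]
        rfl

lemma SmoothSection.continuousOn_chartDiv (g : Metric d M) (p : M)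
    {V : ∀ x : M, TangentSpace (𝓡 d) x} (hV : SmoothSection V) :
    ContinuousOn (chartDiv g p V) (extChartAt (𝓡 d) p).source := by
  have hm : Set.MapsTo (extChartAt (𝓡 d) p) (extChartAt (𝓡 d) p).source
      (extChartAt (𝓡 d) p).target := fun _ hx => (extChartAt (𝓡 d) p).map_source hx
  refine ContinuousOn.mul (ContinuousOn.inv₀ ((continuousOn_volDensity g p).comp
    (continuousOn_extChartAt p) hm) fun x hx => (volDensity_pos g (hm hx)).ne') ?_
  refine continuousOn_finsetSum Finset.univ fun i _ => ?_
  exact (((hV.contDiffOn_fluxComp g p i).continuousOn_fderiv_of_isOpen (isOpen_target p)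
    (by simp)).comp (continuousOn_extChartAt p) hm).clm_apply continuousOn_const

/-- The product rule `div (h V) = h div V + dh(V)`, in a fixed chart. -/
lemma SmoothSection.chartDiv_smul (g : Metric d M) {p x : M}
    {V : ∀ x : M, TangentSpace (𝓡 d) x} (hV : SmoothSection V) {h : M → ℝ}
    (hh : ContMDiff (𝓡 d) 𝓘(ℝ, ℝ) ∞ h) (hx : x ∈ (extChartAt (𝓡 d) p).source) :
    chartDiv g p (fun z => h z • V z) x = h x * chartDiv g p V x + dirDeriv h x (V x) := by
  have hy := (extChartAt (𝓡 d) p).map_source hx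
  have hxy := (extChartAt (𝓡 d) p).left_inv hx
  have hn := (isOpen_target p).mem_nhds hy
  have h1 : ∀ i, fluxComp g p (fun z => h z • V z) i =
      fun y => (h ∘ (extChartAt (𝓡 d) p).symm) y * fluxComp g p V i y := fun i => by
    ext y
    simp only [fluxComp, coord_smul, Function.comp_apply]
    ring
  have hd : DifferentiableAt ℝ (h ∘ (extChartAt (𝓡 d) p).symm) (extChartAt (𝓡 d) p x) :=
    ((contDiffOn_comp_symm hh.contMDiffOn).contDiffAt hn).differentiableAt (by simp)
  have hW : ∀ i, DifferentiableAt ℝ (fluxComp g p V i) (extChartAt (𝓡 d) p x) := fun i =>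
    ((hV.contDiffOn_fluxComp g p i).contDiffAt hn).differentiableAt (by simp)
  have hne := (volDensity_pos g hy).ne'
  rw [chartDiv, chartDiv, dirDeriv_eq_sum hx (hh.mdifferentiableAt (by simp)),
    Finset.mul_sum, Finset.mul_sum, Finset.mul_sum, ← Finset.sum_add_distrib]
  refine Finset.sum_congr rfl fun i _ => ?_
  rw [h1, fderiv_fun_mul hd (hW i)]
  simp only [add_apply, smul_apply, smul_eq_mul, Function.comp_apply, hxy]
  rw [show fluxComp g p V i (extChartAt (𝓡 d) p x) =
    volDensity g p (extChartAt (𝓡 d) p x) * coord p x (V x) i from by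
      rw [fluxComp]
      exact congrArg (fun z => volDensity g p (extChartAt (𝓡 d) p x) * coord p z (V z) i) hxy]
  field_simp

lemma SmoothSection.realDiv_smul (g : Metric d M) {V : ∀ x : M, TangentSpace (𝓡 d) x} (hV : SmoothSection V)
    {h : M → ℝ} (hh : ContMDiff (𝓡 d) 𝓘(ℝ, ℝ) ∞ h) (x : M) :
    realDiv g (fun z => h z • V z) x = h x * realDiv g V x + dirDeriv h x (V x) :=
  hV.chartDiv_smul g hh (mem_extChartAt_source x)

lemma SmoothSection.continuous_mul_chartDiv (g : Metric d M) {p : M}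
    {V : ∀ x : M, TangentSpace (𝓡 d) x} (hV : SmoothSection V) {h : M → ℝ}
    (hh : Continuous h) (hp : tsupport h ⊆ (extChartAt (𝓡 d) p).source) :
    Continuous fun x => h x * chartDiv g p V x := by
  refine continuous_of_tsupport fun x hx => hh.continuousAt.mul ?_
  exact (hV.continuousOn_chartDiv g p).continuousAt
    ((isOpen_source p).mem_nhds (hp (tsupport_mul_subset_left hx)))

lemma SmoothSection.realDiv_add (g : Metric d M) {V W : ∀ x : M, TangentSpace (𝓡 d) x}
    (hV : SmoothSection V) (hW : SmoothSection W) (x : M) :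
    realDiv g (fun z => V z + W z) x = realDiv g V x + realDiv g W x := by
  have hn := (isOpen_target (d := d) x).mem_nhds (mem_extChartAt_target x)
  have h1 : ∀ i, fluxComp g x (fun z => V z + W z) i =
      fun y => fluxComp g x V i y + fluxComp g x W i y := fun i => by
    ext y
    simp only [fluxComp, coord_add]
    ring
  simp only [realDiv_eq_chartDiv, chartDiv]
  rw [← mul_add, ← Finset.sum_add_distrib]
  congr 1
  refine Finset.sum_congr rfl fun i _ => ?_
  rw [h1, fderiv_fun_add
    (((hV.contDiffOn_fluxComp g x i).contDiffAt hn).differentiableAt (by simp))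
    (((hW.contDiffOn_fluxComp g x i).contDiffAt hn).differentiableAt (by simp))]
  rfl

lemma SmoothSection.smul {V : ∀ x : M, TangentSpace (𝓡 d) x} (hV : SmoothSection V) {h : M → ℝ}
    (hh : ContMDiff (𝓡 d) 𝓘(ℝ, ℝ) ∞ h) : SmoothSection fun z => h z • V z :=
  ContMDiff.smul_section hh hV

/-- The integral over `ℝ^d` of a directional derivative of a compactly supported function
vanishes. -/
lemma integral_fderiv_eq_zero {E : Type*} [NormedAddCommGroup E] [NormedSpace ℝ E]
    [FiniteDimensional ℝ E] [MeasurableSpace E] [BorelSpace E] (m : Measure E)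
    [m.IsAddHaarMeasure] {F : E → ℝ} (hF : ContDiff ℝ 1 F) (hc : HasCompactSupport F) (v : E) :
    ∫ y, fderiv ℝ F y v ∂m = 0 := by
  have h1 : Integrable F m := hF.continuous.integrable_of_hasCompactSupport hc
  have h2 : Integrable (fun y => fderiv ℝ F y v) m :=
    ((hF.continuous_fderiv (by simp)).clm_apply continuous_const).integrable_of_hasCompactSupport
      (hc.fderiv_apply (𝕜 := ℝ) v)
  simpa using integral_mul_fderiv_eq_neg_fderiv_mul_of_integrable (μ := m) (f := fun _ => (1 : ℝ))
    (g := F) (v := v) (by simp) (by simpa using h2) (by simpa using h1) (fun _ _ => by fun_prop)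
    (fun _ _ => hF.differentiable (by simp) _)

variable [MeasurableSpace M] [BorelSpace M] [CompactSpace M]

/-- The divergence of a field supported in a closed subset of a chart domain has integral zero. -/
lemma setIntegral_chartDiv_eq_zero (g : Metric d M) (p : M)
    {V : ∀ x : M, TangentSpace (𝓡 d) x} (hV : SmoothSection V) {K : Set M} (hK : IsClosed K)
    (hKp : K ⊆ (extChartAt (𝓡 d) p).source) (hVK : ∀ x ∉ K, V x = 0) :
    ∫ x in (extChartAt (𝓡 d) p).source, chartDiv g p V x ∂(riemannianMeasure g) = 0 := by
  have hT := (isOpen_target (d := d) p).measurableSet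
  have hS := (isOpen_source (d := d) p).measurableSet
  have hAE : AEStronglyMeasurable
      ((extChartAt (𝓡 d) p).source.indicator (chartDiv g p V)) (chartMeasure g p) :=
    (aestronglyMeasurable_indicator_iff hS).2
      ((hV.continuousOn_chartDiv g p).aestronglyMeasurable hS)
  rw [riemannianMeasure_restrict_source, ← integral_indicator hS, integral_chartMeasure g p hAE]
  -- the flux components, extended by zero outside the image of the chart
  let W : Fin d → Model d → ℝ := fun i => (extChartAt (𝓡 d) p).target.indicator (fluxComp g p V i)
  have hKc : IsCompact (extChartAt (𝓡 d) p '' K) :=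
    hK.isCompact.image_of_continuousOn ((continuousOn_extChartAt p).mono hKp)
  have hW0 : ∀ i, ∀ y ∉ extChartAt (𝓡 d) p '' K, W i y = 0 := by
    intro i y hy
    by_cases hyT : y ∈ (extChartAt (𝓡 d) p).target
    · have hn : (extChartAt (𝓡 d) p).symm y ∉ K := fun h =>
        hy ⟨_, h, (extChartAt (𝓡 d) p).right_inv hyT⟩
      simp only [W, Set.indicator_of_mem hyT, fluxComp, hVK _ hn, coord_eq_coordL, map_zero,
        mul_zero]
    · simp only [W, Set.indicator_of_notMem hyT]
  have hWc : ∀ i, HasCompactSupport (W i) := fun i => HasCompactSupport.intro hKc (hW0 i)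
  have hWd : ∀ i, ContDiff ℝ 1 (W i) := by
    intro i
    refine contDiff_iff_contDiffAt.2 fun y => ?_
    by_cases hy : y ∈ extChartAt (𝓡 d) p '' K
    · have hyT : y ∈ (extChartAt (𝓡 d) p).target := by
        obtain ⟨x, hx, rfl⟩ := hy
        exact (extChartAt (𝓡 d) p).map_source (hKp hx)
      have hn := (isOpen_target p).mem_nhds hyT
      refine (((hV.contDiffOn_fluxComp g p i).contDiffAt hn).of_le (by simp)).congr_of_eventuallyEq
        ?_
      filter_upwards [hn] with z hz
      simp only [W, Set.indicator_of_mem hz]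
    · refine (contDiffAt_const (c := (0 : ℝ))).congr_of_eventuallyEq ?_
      filter_upwards [hKc.isClosed.isOpen_compl.mem_nhds hy] with z hz
      exact hW0 i z hz
  have key : ∀ y ∈ (extChartAt (𝓡 d) p).target, volDensity g p y •
      (extChartAt (𝓡 d) p).source.indicator (chartDiv g p V) ((extChartAt (𝓡 d) p).symm y) =
        ∑ i, fderiv ℝ (W i) y (EuclideanSpace.single i (1 : ℝ)) := by
    intro y hy
    rw [Set.indicator_of_mem ((extChartAt (𝓡 d) p).map_target hy), chartDiv,
      (extChartAt (𝓡 d) p).right_inv hy, smul_eq_mul, mul_inv_cancel_left₀ (volDensity_pos g hy).ne']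
    refine Finset.sum_congr rfl fun i _ => ?_
    have h : W i =ᶠ[𝓝 y] fluxComp g p V i := by
      filter_upwards [(isOpen_target p).mem_nhds hy] with z hz
      simp only [W, Set.indicator_of_mem hz]
    rw [h.fderiv_eq]
  rw [setIntegral_congr_fun hT key, setIntegral_eq_integral_of_forall_compl_eq_zero]
  · rw [integral_finsetSum]
    · exact Finset.sum_eq_zero fun i _ => integral_fderiv_eq_zero volume (hWd i) (hWc i) _
    · intro i _
      exact (((hWd i).continuous_fderiv (by simp)).clm_apply
        continuous_const).integrable_of_hasCompactSupport ((hWc i).fderiv_apply (𝕜 := ℝ) _)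
  · intro y hy
    refine Finset.sum_eq_zero fun i _ => ?_
    have h : W i =ᶠ[𝓝 y] fun _ => 0 := by
      have hy' : y ∉ extChartAt (𝓡 d) p '' K := by
        rintro ⟨x, hx, rfl⟩
        exact hy ((extChartAt (𝓡 d) p).map_source (hKp hx))
      filter_upwards [hKc.isClosed.isOpen_compl.mem_nhds hy'] with z hz
      exact hW0 i z hz
    rw [h.fderiv_eq]
    simp

/-- Integration by parts against a function supported in a chart domain. -/
lemma integral_mul_chartDiv_add (g : Metric d M) (p : M)
    {V : ∀ x : M, TangentSpace (𝓡 d) x} (hV : SmoothSection V) {h : M → ℝ}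
    (hh : ContMDiff (𝓡 d) 𝓘(ℝ, ℝ) ∞ h) (hp : tsupport h ⊆ (extChartAt (𝓡 d) p).source) :
    ∫ x, (h x * chartDiv g p V x + dirDeriv h x (V x)) ∂(riemannianMeasure g) = 0 := by
  rw [← setIntegral_chartDiv_eq_zero g p (hV.smul hh) (isClosed_tsupport h) hp fun x hx => by
    rw [image_eq_zero_of_notMem_tsupport hx, zero_smul],
    ← setIntegral_eq_integral_of_forall_compl_eq_zero (s := (extChartAt (𝓡 d) p).source)]
  · exact setIntegral_congr_fun (isOpen_source p).measurableSet fun x hx =>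
      (hV.chartDiv_smul g hh hx).symm
  · intro x hx
    rw [image_eq_zero_of_notMem_tsupport fun h => hx (hp h),
      dirDeriv_eq_zero_of_notMem_tsupport fun h => hx (hp h)]
    simp

variable (g : Metric d M) [IsFiniteMeasure (riemannianMeasure g)]

lemma integrable_of_continuous {F : Type*} [NormedAddCommGroup F] {f : M → F}
    (hf : Continuous f) : Integrable f (riemannianMeasure g) :=
  hf.integrable_of_hasCompactSupport (HasCompactSupport.of_compactSpace f)

variable [T2Space M]

/-- The divergence does not depend on the chart. Both sides are continuous, and by integration by
parts they have the same integral against every test function supported in the overlap. -/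
lemma SmoothSection.chartDiv_eq_of_mem {p q x : M}
    {V : ∀ x : M, TangentSpace (𝓡 d) x} (hV : SmoothSection V)
    (hp : x ∈ (extChartAt (𝓡 d) p).source) (hq : x ∈ (extChartAt (𝓡 d) q).source) :
    chartDiv g p V x = chartDiv g q V x := by
  set U := (extChartAt (𝓡 d) p).source ∩ (extChartAt (𝓡 d) q).source with hU
  have hUo : IsOpen U := (isOpen_source p).inter (isOpen_source q)
  have hcp : ContinuousOn (chartDiv g p V) U :=
    (hV.continuousOn_chartDiv g p).mono Set.inter_subset_left
  have hcq : ContinuousOn (chartDiv g q V) U :=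
    (hV.continuousOn_chartDiv g q).mono Set.inter_subset_right
  have hae := hUo.ae_eq_zero_of_integral_contMDiff_smul_eq_zero (𝓡 d)
    (f := fun z => chartDiv g p V z - chartDiv g q V z) (μ := riemannianMeasure g)
    ((hcp.sub hcq).locallyIntegrableOn hUo.measurableSet) (by
      intro h hh _ hsupp
      have h1 := integral_mul_chartDiv_add g p hV hh (hsupp.trans Set.inter_subset_left)
      have h2 := integral_mul_chartDiv_add g q hV hh (hsupp.trans Set.inter_subset_right)
      have i0 := integrable_of_continuous g (hV.continuous_dirDeriv hh)
      have i1 := integrable_of_continuous g (hV.continuous_mul_chartDiv g hh.continuous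
        (hsupp.trans Set.inter_subset_left))
      have i2 := integrable_of_continuous g (hV.continuous_mul_chartDiv g hh.continuous
        (hsupp.trans Set.inter_subset_right))
      rw [integral_add i1 i0] at h1
      rw [integral_add i2 i0] at h2
      simp only [smul_eq_mul, mul_sub]
      rw [integral_sub i1 i2]
      linarith)
  have heq : chartDiv g p V =ᵐ[(riemannianMeasure g).restrict U] chartDiv g q V := by
    rw [EventuallyEq, ae_restrict_iff' hUo.measurableSet]
    filter_upwards [hae] with z hz hzU using sub_eq_zero.1 (hz hzU)
  exact Measure.eqOn_open_of_ae_eq heq hUo hcp hcq ⟨hp, hq⟩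

lemma SmoothSection.realDiv_eq {p x : M} {V : ∀ x : M, TangentSpace (𝓡 d) x}
    (hV : SmoothSection V) (hp : x ∈ (extChartAt (𝓡 d) p).source) :
    realDiv g V x = chartDiv g p V x :=
  hV.chartDiv_eq_of_mem g (mem_extChartAt_source x) hp

lemma SmoothSection.continuous_realDiv {V : ∀ x : M, TangentSpace (𝓡 d) x}
    (hV : SmoothSection V) : Continuous (realDiv g V) := by
  refine continuous_iff_continuousAt.2 fun p => ?_
  have hn := (isOpen_source (d := d) p).mem_nhds (mem_extChartAt_source p)
  refine ((hV.continuousOn_chartDiv g p).continuousAt hn).congr ?_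
  filter_upwards [hn] with x hx using (hV.realDiv_eq g hx).symm

/-- The divergence theorem on a closed manifold. -/
lemma SmoothSection.integral_realDiv {V : ∀ x : M, TangentSpace (𝓡 d) x}
    (hV : SmoothSection V) : ∫ x, realDiv g V x ∂(riemannianMeasure g) = 0 := by
  obtain ⟨t, ht⟩ := isCompact_univ.elim_finite_subcover
    (fun p : M => (extChartAt (𝓡 d) p).source) (fun p => isOpen_source p)
    fun x _ => Set.mem_iUnion.2 ⟨x, mem_extChartAt_source x⟩
  let c : Fin t.card → M := fun n => (t.equivFin.symm n : M)
  have hc : Set.univ ⊆ ⋃ n, (extChartAt (𝓡 d) (c n)).source := by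
    intro x hx
    obtain ⟨p, hp, hxp⟩ := Set.mem_iUnion₂.1 (ht hx)
    refine Set.mem_iUnion.2 ⟨t.equivFin ⟨p, hp⟩, ?_⟩
    simpa [c] using hxp
  obtain ⟨ρ, hρ⟩ := SmoothPartitionOfUnity.exists_isSubordinate (𝓡 d) isClosed_univ
    (fun n => (extChartAt (𝓡 d) (c n)).source) (fun n => isOpen_source (c n)) hc
  have hsum : ∀ x, ∑ n, ρ n x = 1 := fun x => by
    rw [← finsum_eq_sum_of_fintype]
    exact ρ.sum_eq_one (Set.mem_univ x)
  have hint : ∀ n, ∫ x, (ρ n x * realDiv g V x + dirDeriv (ρ n) x (V x))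
      ∂(riemannianMeasure g) = 0 := by
    intro n
    rw [← integral_mul_chartDiv_add g (c n) hV (ρ n).contMDiff (hρ n)]
    congr 1
    ext x
    by_cases hx : x ∈ (extChartAt (𝓡 d) (c n)).source
    · rw [hV.realDiv_eq g hx]
    · rw [image_eq_zero_of_notMem_tsupport fun h => hx (hρ n h), zero_mul, zero_mul]
  have hpt : ∀ x, realDiv g V x =
      ∑ n, (ρ n x * realDiv g V x + dirDeriv (ρ n) x (V x)) := by
    intro x
    rw [Finset.sum_add_distrib, ← Finset.sum_mul, hsum, one_mul,
      sum_dirDeriv fun n => (ρ n).contMDiff.mdifferentiableAt (by simp)]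
    simp only [hsum, dirDeriv_const, add_zero]
  calc ∫ x, realDiv g V x ∂(riemannianMeasure g)
      = ∫ x, ∑ n, (ρ n x * realDiv g V x + dirDeriv (ρ n) x (V x)) ∂(riemannianMeasure g) := by
        congr 1
        exact funext hpt
    _ = 0 := by
        rw [integral_finsetSum]
        · exact Finset.sum_eq_zero fun n _ => hint n
        · exact fun n _ => integrable_of_continuous g
            (((ρ n).contMDiff.continuous.mul (hV.continuous_realDiv g)).add
              (hV.continuous_dirDeriv (ρ n).contMDiff))

end Divergence

/-! ### Complex vector fields acting on smooth functions -/

section ComplexFields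

variable {d : ℕ} {M : Type*} [TopologicalSpace M] [ChartedSpace (Model d) M]

lemma CField.apply_eq (v : CField d M) (f : M → ℂ) (x : M) :
    v.apply f x = dirDeriv f x (v.re x) + Complex.I * dirDeriv f x (v.im x) := rfl

lemma CField.sub_apply (v w : CField d M) (f : M → ℂ) (x : M) :
    (v.sub w).apply f x = v.apply f x - w.apply f x := by
  simp only [apply_eq, CField.sub, dirDeriv_sub_vec]
  ring

lemma CField.smul_sub (f : M → ℂ) (v w : CField d M) :
    (CField.smul f v).sub (CField.smul f w) = CField.smul f (v.sub w) := by
  ext x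
  · simp only [CField.sub, CField.smul, _root_.smul_sub]
    abel
  · simp only [CField.sub, CField.smul, _root_.smul_sub]
    abel

lemma CField.apply_mul (v : CField d M) {f h : M → ℂ} {x : M}
    (hf : MDifferentiableAt (𝓡 d) 𝓘(ℝ, ℂ) f x) (hh : MDifferentiableAt (𝓡 d) 𝓘(ℝ, ℂ) h x) :
    v.apply (fun z => f z * h z) x = f x * v.apply h x + h x * v.apply f x := by
  simp only [apply_eq, dirDeriv_mul hf hh]
  ring

lemma CField.apply_add (v : CField d M) {f h : M → ℂ} {x : M}
    (hf : MDifferentiableAt (𝓡 d) 𝓘(ℝ, ℂ) f x) (hh : MDifferentiableAt (𝓡 d) 𝓘(ℝ, ℂ) h x) :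
    v.apply (fun z => f z + h z) x = v.apply f x + v.apply h x := by
  simp only [apply_eq, dirDeriv_add hf hh]
  ring

lemma CField.apply_const (v : CField d M) (a : ℂ) (x : M) :
    v.apply (fun _ => a) x = 0 := by
  simp [apply_eq, dirDeriv_const]

lemma CField.conj_apply (v : CField d M) {f : M → ℂ} {x : M}
    (hf : MDifferentiableAt (𝓡 d) 𝓘(ℝ, ℂ) f x) :
    v.apply (fun z => (starRingEnd ℂ) (f z)) x = (starRingEnd ℂ) (v.conj.apply f x) := by
  have h : ∀ u, dirDeriv (fun z => (starRingEnd ℂ) (f z)) x u =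
      (starRingEnd ℂ) (dirDeriv f x u) := fun u =>
    dirDeriv_comp_clm (Complex.conjCLE : ℂ →L[ℝ] ℂ) hf u
  simp [apply_eq, h, CField.conj, dirDeriv_neg_vec]

lemma Smooth.mdifferentiableAt (f : Smooth d M) (x : M) :
    MDifferentiableAt (𝓡 d) 𝓘(ℝ, ℂ) (f : M → ℂ) x := f.2.mdifferentiableAt (by simp)

/-- The complex conjugate of a smooth function. -/
def Smooth.conj (f : Smooth d M) : Smooth d M :=
  ⟨fun x => (starRingEnd ℂ) ((f : M → ℂ) x),
    (ContinuousLinearMap.contMDiff (Complex.conjCLE : ℂ →L[ℝ] ℂ)).comp f.2⟩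

lemma contMDiff_ofReal {h : M → ℝ} (hh : ContMDiff (𝓡 d) 𝓘(ℝ, ℝ) ∞ h) :
    ContMDiff (𝓡 d) 𝓘(ℝ, ℂ) ∞ fun x => (h x : ℂ) :=
  (ContinuousLinearMap.contMDiff Complex.ofRealCLM).comp hh

lemma Smooth.exists_bound [CompactSpace M] (f : Smooth d M) :
    ∃ C : ℝ, 0 ≤ C ∧ ∀ x, ‖(f : M → ℂ) x‖ ≤ C := by
  obtain ⟨C, hC⟩ := isCompact_univ.exists_bound_of_continuousOn f.2.continuous.continuousOn
  exact ⟨max C 0, le_max_right _ _, fun x => (hC x (Set.mem_univ x)).trans (le_max_left _ _)⟩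

variable [IsManifold (𝓡 d) ∞ M]

lemma CField.IsSmooth.smul {v : CField d M} (hv : v.IsSmooth) (f : Smooth d M) :
    (CField.smul (f : M → ℂ) v).IsSmooth := by
  have hre : ContMDiff (𝓡 d) 𝓘(ℝ, ℝ) ∞ fun x => ((f : M → ℂ) x).re :=
    (ContinuousLinearMap.contMDiff Complex.reCLM).comp f.2
  have him : ContMDiff (𝓡 d) 𝓘(ℝ, ℝ) ∞ fun x => ((f : M → ℂ) x).im :=
    (ContinuousLinearMap.contMDiff Complex.imCLM).comp f.2
  exact ⟨(hre.smul_section hv.1).sub_section (him.smul_section hv.2),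
    (hre.smul_section hv.2).add_section (him.smul_section hv.1)⟩

/-- The product rule `div (f v) = f div v + v(f)` for smooth complex fields. -/
lemma CField.IsSmooth.div_smul (g : Metric d M) {v : CField d M} (hv : v.IsSmooth)
    (f : Smooth d M) (x : M) :
    div g (CField.smul (f : M → ℂ) v) x = (f : M → ℂ) x * div g v x + v.apply f x := by
  have hX : SmoothSection v.re := hv.1
  have hY : SmoothSection v.im := hv.2
  have hre : ContMDiff (𝓡 d) 𝓘(ℝ, ℝ) ∞ fun x => ((f : M → ℂ) x).re :=
    (ContinuousLinearMap.contMDiff Complex.reCLM).comp f.2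
  have him : ContMDiff (𝓡 d) 𝓘(ℝ, ℝ) ∞ fun x => ((f : M → ℂ) x).im :=
    (ContinuousLinearMap.contMDiff Complex.imCLM).comp f.2
  have hnim : ContMDiff (𝓡 d) 𝓘(ℝ, ℝ) ∞ fun x => -((f : M → ℂ) x).im :=
    (ContinuousLinearMap.contMDiff (-Complex.imCLM)).comp f.2
  have d1 : ∀ u, dirDeriv (fun x => ((f : M → ℂ) x).re) x u = (dirDeriv (f : M → ℂ) x u).re :=
    fun u => dirDeriv_comp_clm Complex.reCLM (Smooth.mdifferentiableAt f x) u
  have d2 : ∀ u, dirDeriv (fun x => ((f : M → ℂ) x).im) x u = (dirDeriv (f : M → ℂ) x u).im :=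
    fun u => dirDeriv_comp_clm Complex.imCLM (Smooth.mdifferentiableAt f x) u
  have d3 : ∀ u, dirDeriv (fun x => -((f : M → ℂ) x).im) x u = -(dirDeriv (f : M → ℂ) x u).im :=
    fun u => dirDeriv_comp_clm (-Complex.imCLM) (Smooth.mdifferentiableAt f x) u
  have e1 := SmoothSection.realDiv_add g (hX.smul hre) (hY.smul hnim) x
  have e2 := SmoothSection.realDiv_add g (hY.smul hre) (hX.smul him) x
  rw [hX.realDiv_smul g hre, hY.realDiv_smul g hnim, d1, d3] at e1
  rw [hY.realDiv_smul g hre, hX.realDiv_smul g him, d1, d2] at e2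
  simp only [neg_smul, ← sub_eq_add_neg] at e1
  simp only [div, CField.smul]
  rw [e1, e2, CField.apply_eq]
  apply Complex.ext <;> simp <;> ring

open Bundle in
/-- Near `p`, the chart components of a tangent vector are bounded by its Riemannian norm. -/
lemma exists_eventually_norm_components_sq_le (g : Metric d M) (p : M) :
    ∃ C > 0, ∀ᶠ x in 𝓝 p, ∀ u : TangentSpace (𝓡 d) x,
    ‖(trivializationAt (Model d) (TangentSpace (𝓡 d)) p).continuousLinearMapAt ℝ x u‖ ^ 2 ≤
      C ^ 2 * g.inner x u u := by
  let _ : Bundle.RiemannianBundle (fun x : M => TangentSpace (𝓡 d) x) := ⟨g.toRiemannianMetric⟩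
  have : IsContinuousRiemannianBundle (Model d) (fun x : M => TangentSpace (𝓡 d) x) :=
    ⟨g.inner, g.contMDiff.continuous, fun _ _ _ => rfl⟩
  obtain ⟨C, hC0, hC⟩ := eventually_norm_trivializationAt_lt (Model d)
    (fun x : M => TangentSpace (𝓡 d) x) p
  refine ⟨C, hC0, ?_⟩
  filter_upwards [hC] with x hx u
  have h1 : ‖u‖ ^ 2 = g.inner x u u := (real_inner_self_eq_norm_sq u).symm
  rw [← h1, ← mul_pow]
  gcongr
  exact (ContinuousLinearMap.le_opNorm _ u).trans (by gcongr)

lemma metric_self_nonneg (g : Metric d M) (x : M) (u : TangentSpace (𝓡 d) x) :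
    0 ≤ g.inner x u u := by
  by_cases hu : u = 0
  · simp [hu]
  · exact (g.pos x u hu).le

/-- On a compact manifold the derivative of a smooth function is bounded with respect to the
metric. -/
lemma exists_norm_dirDeriv_sq_le [CompactSpace M] (g : Metric d M) {F : Type*}
    [NormedAddCommGroup F] [NormedSpace ℝ F] {f : M → F} (hf : ContMDiff (𝓡 d) 𝓘(ℝ, F) ∞ f) :
    ∃ C : ℝ, 0 ≤ C ∧ ∀ (x : M) (u : TangentSpace (𝓡 d) x),
      ‖dirDeriv f x u‖ ^ 2 ≤ C * g.inner x u u := by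
  have hloc : ∀ p : M, ∃ C : ℝ, 0 ≤ C ∧ ∀ᶠ x in 𝓝 p, ∀ u : TangentSpace (𝓡 d) x,
      ‖dirDeriv f x u‖ ^ 2 ≤ C * g.inner x u u := by
    intro p
    obtain ⟨C, hC0, hC⟩ := exists_eventually_norm_components_sq_le g p
    have hcont : ContinuousAt (fun x => fderiv ℝ (f ∘ (extChartAt (𝓡 d) p).symm)
        (extChartAt (𝓡 d) p x)) p := by
      have h2 := ((contDiffOn_comp_symm (p := p) hf.contMDiffOn).continuousOn_fderiv_of_isOpen
        (isOpen_target p) (by simp)).comp (continuousOn_extChartAt p)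
          fun _ hx => (extChartAt (𝓡 d) p).map_source hx
      exact h2.continuousAt ((isOpen_source p).mem_nhds (mem_extChartAt_source p))
    obtain ⟨D, hD⟩ := hcont.norm.isBoundedUnder_le
    rw [eventually_map] at hD
    refine ⟨D ^ 2 * C ^ 2, by positivity, ?_⟩
    filter_upwards [hC, hD, (isOpen_source (d := d) p).mem_nhds (mem_extChartAt_source p)]
      with x hx hDx hxp u
    have e : dirDeriv f x u = fderiv ℝ (f ∘ (extChartAt (𝓡 d) p).symm) (extChartAt (𝓡 d) p x)
        ((trivializationAt (Model d) (TangentSpace (𝓡 d)) p).continuousLinearMapAt ℝ x u) := by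
      rw [dirDeriv_eq_sum hxp (hf.mdifferentiableAt (by simp))]
      simp only [← map_smul, ← map_sum, coord_eq hxp]
      congr 1
      ext j
      simp [Pi.single_apply]
    have hDx' : ‖fderiv ℝ (f ∘ (extChartAt (𝓡 d) p).symm) (extChartAt (𝓡 d) p x)‖ ≤ D := hDx
    rw [e]
    calc _ ≤ (‖fderiv ℝ (f ∘ (extChartAt (𝓡 d) p).symm) (extChartAt (𝓡 d) p x)‖ *
          ‖(trivializationAt (Model d) (TangentSpace (𝓡 d)) p).continuousLinearMapAt ℝ x u‖) ^ 2 := by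
          gcongr
          exact ContinuousLinearMap.le_opNorm _ _
      _ ≤ D ^ 2 * (C ^ 2 * g.inner x u u) := by
          rw [mul_pow]
          gcongr
          exact hx u
      _ = _ := by ring
  have h := isCompact_univ.induction_on (p := fun s : Set M => ∃ C : ℝ, 0 ≤ C ∧ ∀ x ∈ s,
    ∀ u : TangentSpace (𝓡 d) x, ‖dirDeriv f x u‖ ^ 2 ≤ C * g.inner x u u)
    ⟨0, le_rfl, by simp⟩ (fun s t hst ⟨C, h0, h⟩ => ⟨C, h0, fun x hx => h x (hst hx)⟩)
    (fun s t ⟨C, h0, h⟩ ⟨C', h0', h'⟩ => by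
      refine ⟨max C C', h0.trans (le_max_left _ _), fun x hx u => ?_⟩
      rcases hx with hx | hx
      · exact (h x hx u).trans
          (mul_le_mul_of_nonneg_right (le_max_left _ _) (metric_self_nonneg g x u))
      · exact (h' x hx u).trans
          (mul_le_mul_of_nonneg_right (le_max_right _ _) (metric_self_nonneg g x u)))
    (fun x _ => by
      obtain ⟨C, h0, h⟩ := hloc x
      exact ⟨_, mem_nhdsWithin_of_mem_nhds h, C, h0, fun z hz => hz⟩)
  obtain ⟨C, h0, h⟩ := h
  exact ⟨C, h0, fun x => h x (Set.mem_univ x)⟩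

lemma normSq_nonneg (g : Metric d M) (v : CField d M) (x : M) : 0 ≤ normSq g v x :=
  add_nonneg (metric_self_nonneg g x _) (metric_self_nonneg g x _)

lemma normSq_smul (g : Metric d M) (f : M → ℂ) (v : CField d M) (x : M) :
    normSq g (CField.smul f v) x = ‖f x‖ ^ 2 * normSq g v x := by
  have hs := g.symm x (v.im x) (v.re x)
  rw [← Complex.normSq_eq_norm_sq, Complex.normSq_apply]
  simp only [normSq, CField.smul, map_sub, map_add, map_smul, sub_apply, add_apply, smul_apply,
    smul_eq_mul, hs]
  ring

lemma exists_norm_apply_sq_le [CompactSpace M] (g : Metric d M) (f : Smooth d M) :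
    ∃ C : ℝ, 0 ≤ C ∧ ∀ (v : CField d M) (x : M),
      ‖v.apply (f : M → ℂ) x‖ ^ 2 ≤ C * normSq g v x := by
  obtain ⟨C, h0, hC⟩ := exists_norm_dirDeriv_sq_le g f.2
  refine ⟨2 * C, by positivity, fun v x => ?_⟩
  rw [CField.apply_eq]
  have h1 := hC x (v.re x)
  have h2 := hC x (v.im x)
  have h3 : ‖dirDeriv (f : M → ℂ) x (v.re x) + Complex.I * dirDeriv (f : M → ℂ) x (v.im x)‖ ≤
      ‖dirDeriv (f : M → ℂ) x (v.re x)‖ + ‖dirDeriv (f : M → ℂ) x (v.im x)‖ :=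
    (norm_add_le _ _).trans (by simp)
  have h4 := pow_le_pow_left₀ (norm_nonneg _) h3 2
  have h5 := add_sq_le (a := ‖dirDeriv (f : M → ℂ) x (v.re x)‖)
    (b := ‖dirDeriv (f : M → ℂ) x (v.im x)‖)
  rw [normSq]
  linarith

end ComplexFields

/-! ### The closure of the divergence -/

section WeakDivergence

variable {d : ℕ} {M : Type*} [TopologicalSpace M] [ChartedSpace (Model d) M]

lemma memLp_smooth_mul [MeasurableSpace M] [BorelSpace M] [CompactSpace M] (f : Smooth d M) {k : M → ℂ} {p : ℝ≥0∞}
    {m : Measure M} (hk : MemLp k p m) : MemLp (fun x => (f : M → ℂ) x * k x) p m := by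
  obtain ⟨C, h0, hC⟩ := Smooth.exists_bound f
  refine hk.of_le_mul (c := C) (f.2.continuous.aestronglyMeasurable.mul hk.1) ?_
  refine Eventually.of_forall fun x => ?_
  rw [norm_mul]
  gcongr
  exact hC x

lemma CField.IsMeasurable.smul [MeasurableSpace M] [BorelSpace M] {v : CField d M} (hv : v.IsMeasurable)
    (f : Smooth d M) : (CField.smul (f : M → ℂ) v).IsMeasurable := by
  intro p i
  have hf : Measurable fun x : (extChartAt (𝓡 d) p).source => (f : M → ℂ) x :=
    f.2.continuous.measurable.comp measurable_subtype_coe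
  have hre := Complex.measurable_re.comp hf
  have him := Complex.measurable_im.comp hf
  constructor
  · convert (hre.mul (hv p i).1).sub (him.mul (hv p i).2) using 1
    ext x
    simp only [CField.smul, coord_sub, coord_smul]
    rfl
  · convert (hre.mul (hv p i).2).add (him.mul (hv p i).1) using 1
    ext x
    simp only [CField.smul, coord_add, coord_smul]
    rfl

variable [IsManifold (𝓡 d) ∞ M] [MeasurableSpace M]

lemma CField.IsMeasurable.aemeasurable_apply [BorelSpace M] [CompactSpace M] {v : CField d M}
    (hv : v.IsMeasurable) (f : Smooth d M) (m : Measure M) :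
    AEMeasurable (v.apply (f : M → ℂ)) m := by
  obtain ⟨s, hs, hcov⟩ := countable_cover_nhds_of_sigmaCompact
    fun x : M => extChartAt_source_mem_nhds (I := 𝓡 d) x
  have := hs.to_subtype
  rw [Set.biUnion_eq_iUnion] at hcov
  rw [← Measure.restrict_univ (μ := m), ← hcov, aemeasurable_iUnion_iff]
  rintro ⟨p, -⟩
  refine aemeasurable_restrict_of_measurable_subtype (isOpen_source (d := d) p).measurableSet ?_
  have hD : ∀ i : Fin d, Measurable fun x : (extChartAt (𝓡 d) p).source =>
      fderiv ℝ ((f : M → ℂ) ∘ (extChartAt (𝓡 d) p).symm) (extChartAt (𝓡 d) p x)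
        (EuclideanSpace.single i (1 : ℝ)) := fun i => by
    have h2 := ((contDiffOn_comp_symm (p := p) f.2.contMDiffOn).continuousOn_fderiv_of_isOpen
      (isOpen_target p) (by simp)).comp (continuousOn_extChartAt p)
        fun _ hx => (extChartAt (𝓡 d) p).map_source hx
    exact (h2.clm_apply
      (continuousOn_const (c := EuclideanSpace.single i (1 : ℝ)))).domRestrict.measurable
  have hsum : ∀ w : ∀ x : M, TangentSpace (𝓡 d) x,
      (∀ i, Measurable fun x : (extChartAt (𝓡 d) p).source => coord p x.1 (w x.1) i) →
      Measurable fun x : (extChartAt (𝓡 d) p).source => dirDeriv (f : M → ℂ) x.1 (w x.1) := by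
    intro w hw
    convert Finset.measurable_sum Finset.univ fun i _ => (hw i).smul (hD i) using 1
    ext x
    rw [dirDeriv_eq_sum x.2 (Smooth.mdifferentiableAt f x.1)]
    rfl
  exact (hsum _ fun i => (hv p i).1).add ((hsum _ fun i => (hv p i).2).const_mul Complex.I)

/-- A pointwise bound `‖F‖² ≤ C g(v, v)` bounds the norm of `F` in `H` by that of `v` in `H_𝔛`. -/
lemma eLpNorm_le_energy (g : Metric d M) {F : M → ℂ} {v : CField d M} {C : ℝ} (hC : 0 ≤ C)
    (h : ∀ x, ‖F x‖ ^ 2 ≤ C * normSq g v x) :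
    eLpNorm F 2 (riemannianMeasure g) ≤ (ENNReal.ofReal C * energy g v) ^ (1 / 2 : ℝ) := by
  rw [eLpNorm_eq_lintegral_rpow_enorm_toReal (by simp) (by simp), ENNReal.toReal_ofNat, energy,
    ← lintegral_const_mul' _ _ ENNReal.ofReal_ne_top]
  gcongr with x
  rw [← ENNReal.ofReal_mul hC, ENNReal.rpow_ofNat, ← ofReal_norm, ← ENNReal.ofReal_pow (by simp)]
  exact ENNReal.ofReal_le_ofReal (h x)

lemma energy_smul_le (g : Metric d M) {f : M → ℂ} {C : ℝ} (hf : ∀ x, ‖f x‖ ≤ C)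
    (v : CField d M) : energy g (CField.smul f v) ≤ ENNReal.ofReal (C ^ 2) * energy g v := by
  rw [energy, energy, ← lintegral_const_mul' _ _ ENNReal.ofReal_ne_top]
  gcongr with x
  rw [← ENNReal.ofReal_mul (by positivity), normSq_smul]
  have := normSq_nonneg g v x
  gcongr
  exact hf x

variable {g : Metric d M}

lemma MemHX.memLp_apply [BorelSpace M] [CompactSpace M] {v : CField d M} (hv : MemHX g v)
    (f : Smooth d M) : MemLp (v.apply (f : M → ℂ)) 2 (riemannianMeasure g) := by
  obtain ⟨C, h0, hC⟩ := exists_norm_apply_sq_le g f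
  refine ⟨(hv.1.aemeasurable_apply f _).aestronglyMeasurable,
    (eLpNorm_le_energy g h0 (hC v)).trans_lt ?_⟩
  exact ENNReal.rpow_lt_top_of_nonneg (by norm_num)
    (ENNReal.mul_ne_top ENNReal.ofReal_ne_top hv.2.ne)

lemma MemHX.smul [BorelSpace M] [CompactSpace M] {v : CField d M} (hv : MemHX g v)
    (f : Smooth d M) : MemHX g (CField.smul (f : M → ℂ) v) := by
  obtain ⟨C, h0, hC⟩ := Smooth.exists_bound f
  exact ⟨hv.1.smul f, (energy_smul_le g hC v).trans_lt
    (ENNReal.mul_lt_top ENNReal.ofReal_lt_top hv.2)⟩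

variable [BorelSpace M] [CompactSpace M] [T2Space M]

lemma ae_eq_zero_of_integral_smooth_mul_eq_zero {F : M → ℂ}
    (hF : Integrable F (riemannianMeasure g))
    (h : ∀ f : Smooth d M, ∫ x, (f : M → ℂ) x * F x ∂(riemannianMeasure g) = 0) :
    ∀ᵐ x ∂(riemannianMeasure g), F x = 0 := by
  refine ae_eq_zero_of_integral_contMDiff_smul_eq_zero (𝓡 d) hF.locallyIntegrable
    fun a ha _ => ?_
  have := h ⟨_, contMDiff_ofReal ha⟩
  simpa using this

variable [IsProbabilityMeasure (riemannianMeasure g)]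

lemma CField.IsSmooth.continuous_div {v : CField d M} (hv : v.IsSmooth) :
    Continuous (div g v) := by
  have h1 := SmoothSection.continuous_realDiv g hv.1
  have h2 := SmoothSection.continuous_realDiv g hv.2
  exact (Complex.continuous_ofReal.comp h1).add
    (continuous_const.mul (Complex.continuous_ofReal.comp h2))

lemma CField.IsSmooth.integral_div {v : CField d M} (hv : v.IsSmooth) :
    ∫ x, div g v x ∂(riemannianMeasure g) = 0 := by
  have h1 := SmoothSection.continuous_realDiv g hv.1
  have h2 := SmoothSection.continuous_realDiv g hv.2
  have i1 : Integrable (fun x => (realDiv g v.re x : ℂ)) (riemannianMeasure g) :=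
    integrable_of_continuous g (Complex.continuous_ofReal.comp h1)
  have i2 : Integrable (fun x => Complex.I * (realDiv g v.im x : ℂ)) (riemannianMeasure g) :=
    integrable_of_continuous g (continuous_const.mul (Complex.continuous_ofReal.comp h2))
  simp only [div]
  rw [integral_add i1 i2,
    integral_const_mul, integral_complex_ofReal, integral_complex_ofReal,
    SmoothSection.integral_realDiv g hv.1, SmoothSection.integral_realDiv g hv.2]
  simp

/-- The product rule `div (f v) = f div v + v(f)` for the closure of the divergence. The terms
`v(f)` pass to the limit because `df` is bounded. -/
lemma HasDiv.smul {v : CField d M} {k : H g} (h : HasDiv g v k) (f : Smooth d M) {K : H g}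
    (hK : ∀ᵐ x ∂(riemannianMeasure g), K x = (f : M → ℂ) x * k x + v.apply (f : M → ℂ) x) :
    HasDiv g (CField.smul (f : M → ℂ) v) K := by
  obtain ⟨hv, V, hV, hE, hD⟩ := h
  obtain ⟨B, hB0, hB⟩ := Smooth.exists_bound f
  obtain ⟨C, hC0, hC⟩ := exists_norm_apply_sq_le g f
  refine ⟨hv.smul f, fun n => CField.smul (f : M → ℂ) (V n), fun n => (hV n).smul f, ?_, ?_⟩
  · have h0 := ENNReal.Tendsto.const_mul (a := ENNReal.ofReal (B ^ 2)) hE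
      (Or.inr ENNReal.ofReal_ne_top)
    rw [mul_zero] at h0
    refine tendsto_of_tendsto_of_tendsto_of_le_of_le tendsto_const_nhds h0 (fun _ => zero_le)
      fun n => ?_
    simp only [CField.smul_sub]
    exact energy_smul_le g hB _
  · have h1 := ENNReal.Tendsto.const_mul (a := ENNReal.ofReal B) hD
      (Or.inr ENNReal.ofReal_ne_top)
    have h2 := (ENNReal.Tendsto.const_mul (a := ENNReal.ofReal C) hE
      (Or.inr ENNReal.ofReal_ne_top)).ennrpow_const (1 / 2 : ℝ)
    have h3 := h1.add h2
    rw [mul_zero, mul_zero, ENNReal.zero_rpow_of_pos (by norm_num), add_zero] at h3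
    refine tendsto_of_tendsto_of_tendsto_of_le_of_le tendsto_const_nhds h3 (fun _ => zero_le)
      fun n => ?_
    have hVn : AEMeasurable ((V n).apply (f : M → ℂ)) (riemannianMeasure g) :=
      ((SmoothSection.continuous_dirDeriv (hV n).1 f.2).add (continuous_const.mul
        (SmoothSection.continuous_dirDeriv (hV n).2 f.2))).aemeasurable
    have e : (fun x => div g (CField.smul (f : M → ℂ) (V n)) x - K x)
        =ᵐ[riemannianMeasure g] (fun x => (f : M → ℂ) x * (div g (V n) x - k x)) +
          ((V n).sub v).apply (f : M → ℂ) := by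
      filter_upwards [hK] with x hx
      rw [hx, (hV n).div_smul, Pi.add_apply, CField.sub_apply]
      ring
    rw [eLpNorm_congr_ae e]
    refine (eLpNorm_add_le ?_ ?_ (by norm_num)).trans (add_le_add ?_ ?_)
    · exact f.2.continuous.aestronglyMeasurable.mul
        ((hV n).continuous_div.aestronglyMeasurable.sub (Lp.aestronglyMeasurable k))
    · refine AEStronglyMeasurable.congr (hVn.sub
        (hv.1.aemeasurable_apply f _)).aestronglyMeasurable (Eventually.of_forall fun x => ?_)
      exact (CField.sub_apply _ _ _ _).symm
    · refine eLpNorm_le_mul_eLpNorm_of_ae_le_mul (Eventually.of_forall fun x => ?_) 2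
      rw [norm_mul]
      gcongr
      exact hB x
    · exact eLpNorm_le_energy g hC0 (hC _)

/-- The divergence theorem for the closure of the divergence. -/
lemma HasDiv.integral_eq_zero {v : CField d M} {k : H g} (h : HasDiv g v k) :
    ∫ x, k x ∂(riemannianMeasure g) = 0 := by
  obtain ⟨hv, V, hV, hE, hD⟩ := h
  have hm : ∀ n, AEStronglyMeasurable (fun x => div g (V n) x - k x) (riemannianMeasure g) :=
    fun n => (hV n).continuous_div.aestronglyMeasurable.sub (Lp.aestronglyMeasurable k)
  have ht := tendsto_integral_of_L1' (μ := riemannianMeasure g) (fun x => k x)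
    (Lp.aestronglyMeasurable k) (F := fun n x => div g (V n) x) (l := atTop)
    (Eventually.of_forall fun n => integrable_of_continuous g (hV n).continuous_div)
    (tendsto_of_tendsto_of_tendsto_of_le_of_le tendsto_const_nhds hD (fun _ => zero_le)
      fun n => eLpNorm_le_eLpNorm_of_exponent_le (by norm_num) (hm n))
  exact tendsto_nhds_unique ht (tendsto_const_nhds.congr fun n => (hV n).integral_div.symm)

/-- The weak form of `div v = k`: `∫ f k = -∫ v(f)` for every smooth `f`. -/
lemma HasDiv.integral_mul_add_apply {v : CField d M} {k : H g} (h : HasDiv g v k)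
    (f : Smooth d M) :
    ∫ x, ((f : M → ℂ) x * k x + v.apply (f : M → ℂ) x) ∂(riemannianMeasure g) = 0 := by
  have hL : MemLp (fun x => (f : M → ℂ) x * k x + v.apply (f : M → ℂ) x) 2
      (riemannianMeasure g) := (memLp_smooth_mul f (Lp.memLp k)).add (h.1.memLp_apply f)
  rw [← integral_congr_ae hL.coeFn_toLp]
  exact (h.smul f hL.coeFn_toLp).integral_eq_zero

lemma H.eq_of_integral_smooth_mul_eq {k k' : H g}
    (h : ∀ f : Smooth d M, ∫ x, (f : M → ℂ) x * k x ∂(riemannianMeasure g) =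
      ∫ x, (f : M → ℂ) x * k' x ∂(riemannianMeasure g)) : k = k' := by
  have hi : ∀ q : H g, Integrable (fun x => q x) (riemannianMeasure g) := fun q =>
    (Lp.memLp q).integrable (by norm_num)
  have hfi : ∀ (f : Smooth d M) (q : H g),
      Integrable (fun x => (f : M → ℂ) x * q x) (riemannianMeasure g) := fun f q =>
    (memLp_smooth_mul f (Lp.memLp q)).integrable (by norm_num)
  have h0 := ae_eq_zero_of_integral_smooth_mul_eq_zero ((hi k).sub (hi k')) fun f => by
    simp only [Pi.sub_apply, mul_sub]
    rw [integral_sub (hfi f k) (hfi f k'), h, sub_self]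
  refine Lp.ext ?_
  filter_upwards [h0] with x hx using sub_eq_zero.1 hx

/-- The divergence is closable: a field has at most one divergence. -/
lemma HasDiv.unique {v : CField d M} {k k' : H g} (h : HasDiv g v k) (h' : HasDiv g v k') :
    k = k' := by
  refine H.eq_of_integral_smooth_mul_eq fun f => ?_
  have i0 := (h.1.memLp_apply f).integrable (by norm_num)
  have i1 := (memLp_smooth_mul f (Lp.memLp k)).integrable (by norm_num)
  have i2 := (memLp_smooth_mul f (Lp.memLp k')).integrable (by norm_num)
  have e1 := h.integral_mul_add_apply f
  have e2 := h'.integral_mul_add_apply f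
  rw [integral_add i1 i0] at e1
  rw [integral_add i2 i0] at e2
  exact add_right_cancel (e1.trans e2.symm)

lemma HasDiv.existsUnique_smul {v : CField d M} {k : H g} (h : HasDiv g v k) (f : Smooth d M) :
    ∃! K : H g, HasDiv g (CField.smul (f : M → ℂ) v) K := by
  have hL : MemLp (fun x => (f : M → ℂ) x * k x + v.apply (f : M → ℂ) x) 2
      (riemannianMeasure g) := (memLp_smooth_mul f (Lp.memLp k)).add (h.1.memLp_apply f)
  have hK := h.smul f hL.coeFn_toLp
  exact ⟨_, hK, fun K' hK' => hK'.unique hK⟩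

lemma HasDiv.ae_eq_of_smul {v : CField d M} {k : H g} (h : HasDiv g v k) {f : Smooth d M}
    {K : H g} (hK : HasDiv g (CField.smul (f : M → ℂ) v) K) :
    ∀ᵐ x ∂(riemannianMeasure g), K x = (f : M → ℂ) x * k x + v.apply (f : M → ℂ) x := by
  have hL : MemLp (fun x => (f : M → ℂ) x * k x + v.apply (f : M → ℂ) x) 2
      (riemannianMeasure g) := (memLp_smooth_mul f (Lp.memLp k)).add (h.1.memLp_apply f)
  rw [hK.unique (h.smul f hL.coeFn_toLp)]
  exact hL.coeFn_toLp

end WeakDivergence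

/-! ### Fields are determined by their action on smooth functions -/

section Separation

variable {d : ℕ} {M : Type*} [TopologicalSpace M] [ChartedSpace (Model d) M]
  [IsManifold (𝓡 d) ∞ M]

/-- Cut-off coordinate functions: near `p` their differentials are the coordinate forms. -/
lemma exists_smooth_coordinates [T2Space M] (p : M) : ∃ f : Fin d → Smooth d M,
    ∀ᶠ x in 𝓝 p, ∀ (i : Fin d) (u : TangentSpace (𝓡 d) x),
      dirDeriv (f i : M → ℂ) x u = (coord p x u i : ℂ) := by
  let χ : SmoothBumpFunction (𝓡 d) p := Classical.arbitrary _
  let L : Fin d → Model d →L[ℝ] ℂ := fun i =>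
    Complex.ofRealCLM.comp (EuclideanSpace.proj (𝕜 := ℝ) i : Model d →L[ℝ] ℝ)
  have hL : ∀ i, ContMDiff (𝓡 d) 𝓘(ℝ, ℂ) ∞ fun x => χ x • L i (extChartAt (𝓡 d) p x) := fun i =>
    χ.contMDiff_smul ((L i).contMDiff.comp_contMDiffOn contMDiffOn_extChartAt)
  refine ⟨fun i => ⟨_, hL i⟩, ?_⟩
  filter_upwards [eventually_eventually_nhds.2 χ.eventuallyEq_one,
    (isOpen_source (d := d) p).mem_nhds (mem_extChartAt_source p)] with x hx hxp i u
  have e : (fun z => χ z • L i (extChartAt (𝓡 d) p z)) =ᶠ[𝓝 x]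
      fun z => L i (extChartAt (𝓡 d) p z) := by
    filter_upwards [hx] with z hz
    rw [hz, Pi.one_apply, one_smul]
  have h1 : dirDeriv (fun z => χ z • L i (extChartAt (𝓡 d) p z)) x u =
      dirDeriv (fun z => L i (extChartAt (𝓡 d) p z)) x u := by
    unfold dirDeriv
    rw [e.mfderiv_eq]
    rfl
  refine h1.trans ?_
  rw [dirDeriv_comp_clm (L i) ((contMDiffAt_extChartAt' (n := ∞)
    (mem_chart_source hxp)).mdifferentiableAt (by simp))]
  rfl

variable [MeasurableSpace M] {g : Metric d M}

/-- Having divergence `k` depends only on the almost everywhere class of the field; measurability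
in `MemHX` is not invariant under such changes and has to be assumed. -/
lemma HasDiv.congr {u v : CField d M} {k : H g} (h : HasDiv g u k) (huv : AEEq g u v)
    (hv : MemHX g v) : HasDiv g v k := by
  obtain ⟨-, V, hV, hE, hD⟩ := h
  refine ⟨hv, V, hV, ?_, hD⟩
  have e : ∀ n, energy g ((V n).sub v) = energy g ((V n).sub u) := fun n => by
    refine lintegral_congr_ae ?_
    filter_upwards [huv] with x hx
    simp only [normSq, CField.sub, hx.1, hx.2]
  simpa only [e] using hE

/-- A complex vector field is determined almost everywhere by its action on smooth functions. -/
lemma aeEq_of_apply_ae_eq [T2Space M] [CompactSpace M] {u v : CField d M}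
    (h : ∀ f : Smooth d M, ∀ᵐ x ∂(riemannianMeasure g),
      u.apply (f : M → ℂ) x = v.apply (f : M → ℂ) x) : AEEq g u v := by
  have hloc := isCompact_univ.induction_on (p := fun s : Set M =>
    ∀ᵐ x ∂(riemannianMeasure g), x ∈ s → u.re x = v.re x ∧ u.im x = v.im x)
    (by simp) (fun s t hst ht => ht.mono fun x hx hxs => hx (hst hxs))
    (fun s t hs ht => by
      filter_upwards [hs, ht] with x h1 h2 hx
      exact hx.elim h1 h2)
    (fun p _ => by
      obtain ⟨f, hf⟩ := exists_smooth_coordinates (d := d) p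
      refine ⟨_, mem_nhdsWithin_of_mem_nhds (hf.and ((isOpen_source (d := d) p).mem_nhds
        (mem_extChartAt_source p))), ?_⟩
      filter_upwards [ae_all_iff.2 fun i => h (f i)] with x hx hxp
      have hc : ∀ i, coord p x (u.re x) i = coord p x (v.re x) i ∧
          coord p x (u.im x) i = coord p x (v.im x) i := by
        intro i
        have hi := hx i
        rw [CField.apply_eq, CField.apply_eq, hxp.1, hxp.1, hxp.1, hxp.1] at hi
        exact ⟨by simpa using congrArg Complex.re hi, by simpa using congrArg Complex.im hi⟩
      constructor
      · rw [← sum_coord_smul_frame hxp.2 (u.re x), ← sum_coord_smul_frame hxp.2 (v.re x)]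
        simp only [fun i => (hc i).1]
      · rw [← sum_coord_smul_frame hxp.2 (u.im x), ← sum_coord_smul_frame hxp.2 (v.im x)]
        simp only [fun i => (hc i).2])
  exact hloc.mono fun x hx => hx (Set.mem_univ x)

end Separation

/-! ### The skew-adjoint operator of a field -/

section SkewOperator

variable {d : ℕ} {M : Type*} [TopologicalSpace M] [ChartedSpace (Model d) M]

variable [IsManifold (𝓡 d) ∞ M] [MeasurableSpace M] [BorelSpace M] [CompactSpace M]
  {g : Metric d M}

lemma HasDiv.memLp_skew {v : CField d M} {k : H g} (h : HasDiv g v k) (f : Smooth d M) :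
    MemLp (fun x => 2 * v.apply (f : M → ℂ) x + (f : M → ℂ) x * k x) 2 (riemannianMeasure g) :=
  ((h.1.memLp_apply f).const_mul 2).add (memLp_smooth_mul f (Lp.memLp k))

/-- The operator `A_v f = v(f) + div (f v) = 2 v(f) + f div v` of a field `v` with divergence
`k`. -/
def skewOp {v : CField d M} {k : H g} (h : HasDiv g v k) : Smooth d M →ₗ[ℂ] H g where
  toFun f := (h.memLp_skew f).toLp
  map_add' f₁ f₂ := by
    rw [← MemLp.toLp_add]
    refine MemLp.toLp_congr _ _ (Eventually.of_forall fun x => ?_)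
    have e := v.apply_add (Smooth.mdifferentiableAt f₁ x) (Smooth.mdifferentiableAt f₂ x)
    change 2 * v.apply (fun z => (f₁ : M → ℂ) z + (f₂ : M → ℂ) z) x +
      ((f₁ : M → ℂ) x + (f₂ : M → ℂ) x) * k x = (2 * v.apply (f₁ : M → ℂ) x +
        (f₁ : M → ℂ) x * k x) + (2 * v.apply (f₂ : M → ℂ) x + (f₂ : M → ℂ) x * k x)
    rw [e]
    ring
  map_smul' c f := by
    rw [RingHom.id_apply, ← MemLp.toLp_const_smul]
    refine MemLp.toLp_congr _ _ (Eventually.of_forall fun x => ?_)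
    have e := v.apply_mul (f := fun _ => c) mdifferentiableAt_const (Smooth.mdifferentiableAt f x)
    change 2 * v.apply (fun z => c * (f : M → ℂ) z) x + (c * (f : M → ℂ) x) * k x =
      c * (2 * v.apply (f : M → ℂ) x + (f : M → ℂ) x * k x)
    rw [e, v.apply_const]
    ring

lemma coeFn_skewOp {v : CField d M} {k : H g} (h : HasDiv g v k) (f : Smooth d M) :
    ∀ᵐ x ∂(riemannianMeasure g),
      skewOp h f x = 2 * v.apply (f : M → ℂ) x + (f : M → ℂ) x * k x :=
  (h.memLp_skew f).coeFn_toLp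

/-- The field is recovered from its operator: `v(f) = (A_v f - f A_v 1) / 2`. -/
lemma apply_ae_eq_skewOp {v : CField d M} {k : H g} (h : HasDiv g v k) (f : Smooth d M) :
    ∀ᵐ x ∂(riemannianMeasure g),
      v.apply (f : M → ℂ) x = (skewOp h f x - (f : M → ℂ) x * skewOp h 1 x) / 2 := by
  filter_upwards [coeFn_skewOp h f, coeFn_skewOp h 1] with x h1 h2
  have e : v.apply ((1 : Smooth d M) : M → ℂ) x = 0 := v.apply_const 1 x
  rw [h1, h2, e, show ((1 : Smooth d M) : M → ℂ) x = 1 from rfl]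
  ring

variable [T2Space M] [IsProbabilityMeasure (riemannianMeasure g)]

/-- Skew-adjointness `⟨f, A_v h⟩ = -⟨A_{v^*} f, h⟩`: with `F = f̄ h`, the sum of the two sides is
twice `∫ (F div v + v(F)) = 0`. -/
lemma innerH_skewOp {v : CField d M} {k : H g} (hk : HasDiv g v k) {k' : H g}
    (hk' : HasDiv g v.conj k') (f h : Smooth d M) :
    innerH g f (skewOp hk h) = -innerH g (skewOp hk' f) h := by
  have hkk : k' = star k := hk'.unique hk.conj
  have i1 : Integrable (fun x => (starRingEnd ℂ) ((f : M → ℂ) x) * skewOp hk h x)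
      (riemannianMeasure g) :=
    (memLp_smooth_mul (Smooth.conj f) (Lp.memLp (skewOp hk h))).integrable (by norm_num)
  have i2 : Integrable (fun x => (starRingEnd ℂ) (skewOp hk' f x) * (h : M → ℂ) x)
      (riemannianMeasure g) := by
    have := (memLp_smooth_mul h (Lp.memLp (skewOp hk' f)).star).integrable (by norm_num)
    refine this.congr (Eventually.of_forall fun x => ?_)
    exact mul_comm _ _
  rw [eq_neg_iff_add_eq_zero, innerH, innerH, ← integral_add i1 i2]
  have hint := hk.integral_mul_add_apply (Smooth.conj f * h)
  have e : (fun x => (starRingEnd ℂ) ((f : M → ℂ) x) * skewOp hk h x +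
      (starRingEnd ℂ) (skewOp hk' f x) * (h : M → ℂ) x) =ᵐ[riemannianMeasure g]
      fun x => 2 * (((Smooth.conj f * h : Smooth d M) : M → ℂ) x * k x +
        v.apply ((Smooth.conj f * h : Smooth d M) : M → ℂ) x) := by
    filter_upwards [coeFn_skewOp hk h, coeFn_skewOp hk' f, Lp.coeFn_star k] with x h1 h2 h3
    have e1 : v.apply ((Smooth.conj f * h : Smooth d M) : M → ℂ) x =
        (Smooth.conj f : M → ℂ) x * v.apply (h : M → ℂ) x +
          (h : M → ℂ) x * v.apply (Smooth.conj f : M → ℂ) x :=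
      v.apply_mul (Smooth.mdifferentiableAt _ x) (Smooth.mdifferentiableAt _ x)
    have e2 : v.apply (Smooth.conj f : M → ℂ) x =
        (starRingEnd ℂ) (v.conj.apply (f : M → ℂ) x) :=
      v.conj_apply (Smooth.mdifferentiableAt f x)
    have e3 : ((Smooth.conj f * h : Smooth d M) : M → ℂ) x =
        (starRingEnd ℂ) ((f : M → ℂ) x) * (h : M → ℂ) x := rfl
    have e4 : (Smooth.conj f : M → ℂ) x = (starRingEnd ℂ) ((f : M → ℂ) x) := rfl
    have e5 : (starRingEnd ℂ) (k' x) = k x := by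
      rw [hkk, h3, Pi.star_apply, ← starRingEnd_apply, Complex.conj_conj]
    rw [h1, h2, e1, e2, e3, e4, map_add, map_mul, map_mul, e5, map_ofNat]
    ring
  rw [integral_congr_ae e, integral_const_mul, hint, mul_zero]

end SkewOperator

end SEC

end

theorem lemma1 {d : ℕ} {M : Type*} [TopologicalSpace M] [T2Space M] [CompactSpace M]
    [ChartedSpace (SEC.Model d) M] [IsManifold (𝓡 d) ∞ M] [MeasurableSpace M] [BorelSpace M]
    (g : SEC.Metric d M) (hμ : SEC.riemannianMeasure g Set.univ = 1) :
    -- for `v` in `H^1_{𝔛,div}` and `f` smooth, the divergence `D_v f = div (f v)` exists in `H`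
    (∀ (v : SEC.H1div g) (f : SEC.Smooth d M),
      ∃! k : SEC.H g, SEC.HasDiv g (SEC.CField.smul f v.1) k) ∧
    ∃ A : SEC.H1div g → (SEC.Smooth d M →ₗ[ℂ] SEC.H g),
      -- `A_v f = v(f) + D_v f`
      (∀ (v : SEC.H1div g) (f : SEC.Smooth d M) (k : SEC.H g),
        SEC.HasDiv g (SEC.CField.smul f v.1) k →
          ∀ᵐ x ∂(SEC.riemannianMeasure g), A v f x = v.1.apply f x + k x) ∧
      -- `⟨f, A_v h⟩ = -⟨A_{v^*} f, h⟩`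
      (∀ (v : SEC.H1div g) (f h : SEC.Smooth d M),
        SEC.innerH g f (A v h) = -SEC.innerH g (A v.conj f) h) ∧
      -- `A_v` is the only operator with this property
      (∀ (v : SEC.H1div g) (B : SEC.Smooth d M → SEC.H g),
        (∀ f h : SEC.Smooth d M, SEC.innerH g f (B h) = -SEC.innerH g (A v.conj f) h) →
          ∀ f : SEC.Smooth d M, B f = A v f) ∧
      -- distinct elements of `H^1_{𝔛,div}` have distinct operators
      (∀ u v : SEC.H1div g, A u = A v ↔ SEC.AEEq g u.1 v.1) ∧
      -- `v(f) = (A_v f - f A_v 1) / 2`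
      (∀ (v : SEC.H1div g) (f : SEC.Smooth d M),
        ∀ᵐ x ∂(SEC.riemannianMeasure g),
          v.1.apply f x = (A v f x - (f : M → ℂ) x * A v 1 x) / 2) := by
  have : IsProbabilityMeasure (SEC.riemannianMeasure g) := ⟨hμ⟩
  choose k hk using fun v : SEC.H1div g => v.2
  refine ⟨fun v f => (hk v).1.existsUnique_smul f, fun v => SEC.skewOp (hk v).1, ?_, ?_, ?_, ?_,
    fun v f => SEC.apply_ae_eq_skewOp (hk v).1 f⟩
  · intro v f K hK
    filter_upwards [SEC.coeFn_skewOp (hk v).1 f, (hk v).1.ae_eq_of_smul hK] with x h1 h2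
    rw [h1, h2]
    ring
  -- the divergence chosen for `v^*` is the conjugate of that of `v`, by uniqueness
  · exact fun v f h => SEC.innerH_skewOp (hk v).1 (hk v.conj).1 f h
  · intro v B hB f
    refine SEC.H.eq_of_integral_smooth_mul_eq fun h => ?_
    have e := (hB (SEC.Smooth.conj h) f).trans
      (SEC.innerH_skewOp (hk v).1 (hk v.conj).1 (SEC.Smooth.conj h) f).symm
    simpa [SEC.innerH, SEC.Smooth.conj] using e
  · intro u v
    constructor
    · intro huv
      refine SEC.aeEq_of_apply_ae_eq fun f => ?_
      filter_upwards [SEC.apply_ae_eq_skewOp (hk u).1 f, SEC.apply_ae_eq_skewOp (hk v).1 f]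
        with x h1 h2
      have huv' : SEC.skewOp (hk u).1 = SEC.skewOp (hk v).1 := huv
      rw [h1, h2, huv']
    · intro huv
      have hkk : k u = k v := ((hk u).1.congr huv (hk v).1.1).unique (hk v).1
      refine LinearMap.ext fun f => Lp.ext ?_
      filter_upwards [SEC.coeFn_skewOp (hk u).1 f, SEC.coeFn_skewOp (hk v).1 f, huv]
        with x h1 h2 h3
      rw [h1, h2, SEC.CField.apply_eq, SEC.CField.apply_eq, h3.1, h3.2, hkk]
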